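/- **Setting.** Consider the planetary $(1+n)$-body problem with a star of mass $\bar m_0>0$ and planets of masses $\mu\bar m_1,\dots,\mu\bar m_n>0$ ($\mu>0$), and put $M_i=\bar m_0+\mu\bar m_i$, $m_i=\bar m_0\bar m_i/(\bar m_0+\mu\bar m_i)$. For heliocentric coordinates $(y^{(i)},x^{(i)})\in\mathbb R^3\times\mathbb R^3$ with osculating ellipses of semi-axis $a_i$, eccentricity $e_i$ and mean anomaly $\ell_i$ for the two-body Hamiltonians $\frac{|y^{(i)}|^2}{2m_i}-\frac{m_iM_i}{|x^{(i)}|}$, let $C^{(i)}=x^{(i)}\times y^{(i)}$ and $S^{(i)}=\sum_{k\le i}C^{(k)}$. Let $k^{(1)},k^{(2)},k^{(3)}$ be the standard basis of $\mathbb R^3$, and for $u,v\perp w$ let $\alpha_w(u,v)$ be the angle from $u$ to $v$ oriented by $w$. Define the nodes $\nu_i=S^{(i)}\times C^{(i)}$ ($2\le i\le n$), $\nu_1=\nu_2$, $\nu_{n+1}=k^{(3)}\times S^{(n)}$ (for $n=1$ thus $\nu_1=\nu_2=k^{(3)}\times S^{(1)}$), the angles $\psi_i=\alpha_{S^{(i+1)}}(\nu_{i+2},\nu_{i+1})$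 ($1\le i\le n-1$), $\psi_n=\alpha_{k^{(3)}}(k^{(1)},\nu_{n+1})$, $\psi_0=0$, the angle $\gamma_i$ from $\nu_i$ to the perihelion of the $i$-th ellipse, oriented by $C^{(i)}$, and $\sigma_i=\sum_{k=i}^n\psi_k$. The RPS variables $(\Lambda,\lambda,z)$, $z=(\eta,\xi,p,q)\in\mathbb R^{4n}$, are $$\Lambda_i=m_i\sqrt{M_ia_i},\quad \lambda_i=\ell_i+\gamma_i+\sigma_{i-1},\quad \eta_i+\mathrm i\,\xi_i=\sqrt{2(\Lambda_i-|C^{(i)}|)}\;e^{-\mathrm i(\gamma_i+\sigma_{i-1})},\quad p_i+\mathrm i\,q_i=\sqrt{2\tau_i}\;e^{-\mathrm i\sigma_i},$$ with $\tau_i=|C^{(i+1)}|+|S^{(i)}|-|S^{(i+1)}|$ for $i<n$ and $\tau_n=|S^{(n)}|-S^{(n)}\cdot k^{(3)}$. The inverse map $(\Lambda,\lambda,z)\mapsto(y,x)$ extends real-analytically to $\lambda\in\mathbb T^n$, $\mathbb T=\mathbb R/2\pi\mathbb Z$, and to all $(\Lambda,z)$ in the domain $\mathcal D$ where $\Lambda_i>0$,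 $\frac{\eta_i^2+\xi_i^2}2<\Lambda_i$, $\frac{p_i^2+q_i^2}2<2\min\{|S^{(i)}|,|C^{(i+1)}|\}$ for $i<n$, and $\frac{p_n^2+q_n^2}{2}<2|S^{(n)}|$; here $|C^{(i)}|=\Lambda_i-\frac{\eta_i^2+\xi_i^2}2$ and $|S^{(i)}|=\sum_{k\le i}|C^{(k)}|-\sum_{k<i}\frac{p_k^2+q_k^2}2$. In these variables $x^{(i)},y^{(i)}$ depend on $\lambda$ only through $\lambda_i$. For $1\le i<j\le n$ let $$f_{ij}^{(2)}(\Lambda,z)=\frac1{2!}\frac{d^2}{d\varepsilon^2}\Big[\frac1{(2\pi)^2}\int_{\mathbb T^2}\frac{d\lambda_i\,d\lambda_j}{|\varepsilon x^{(i)}(\Lambda,\lambda_i,z)-x^{(j)}(\Lambda,\lambda_j,z)|}\Big]_{\varepsilon=0}$$ be the second-order term of the expansion of the doubly averaged Newtonian interaction in powers of $a_i/a_j$ with $a_j$ fixed, and let $f^{(2)}_{\rm av}=-\sum_{i<j}\bar m_i\bar m_jf_{ij}^{(2)}$. Its planar part is $f_{\rm pl}(\Lambda,\eta,\xi):=f^{(2)}_{\rm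 av}|_{p=q=0}$. **Proposition.** (a) For $(\Lambda,z)\in\mathcal D$ the functions $\lambda_i\mapsto x^{(i)}$ are continuous and do not vanish, $C^{(i)}=C^{(i)}(\Lambda,z)\ne0$ does not depend on $\lambda_i$, the bracket above is twice continuously differentiable in $\varepsilon$ near $0$, and for all $1\le i<j\le n$ $$f_{ij}^{(2)}=-\frac{M_jm_j^2}{4}\;\frac{\frac1{2\pi}\int_{\mathbb T}\big(3(C^{(j)}\cdot x^{(i)})^2-|x^{(i)}|^2|C^{(j)}|^2\big)d\lambda_i}{|C^{(j)}|^4}\;\Big(\frac1{2\pi}\int_{\mathbb T}\frac{d\lambda_j}{|x^{(j)}|^2}\Big).$$ (b) On $\mathcal D$, $f^{(2)}_{\rm av}=f_{\rm pl}+f_{\rm vert}$, where, with $\hat x^{(i)}=x^{(i)}/a_i$, $\hat C^{(j)}=C^{(j)}/|C^{(j)}|$, $a_i=\frac1{M_i}\big(\frac{\Lambda_i}{m_i}\big)^2$ and $e_i^2=\frac{\eta_i^2+\xi_i^2}{\Lambda_i}-\big(\frac{\eta_i^2+\xi_i^2}{2\Lambda_i}\big)^2$, $$f_{\rm pl}=-\frac14\sum_{i<j}\bar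 m_i\bar m_j\frac{a_i^2}{a_j^3}\frac{\frac1{2\pi}\int_{\mathbb T}\frac{d\zeta}{1-e_j\cos\zeta}}{\big(1-\frac{\eta_j^2+\xi_j^2}{2\Lambda_j}\big)^2}\Big(1+\frac32e_i^2\Big),$$ $$f_{\rm vert}=\frac34\sum_{i<j}\bar m_i\bar m_j\frac{a_i^2}{a_j^3}\frac{\frac1{2\pi}\int_{\mathbb T}\frac{d\zeta}{1-e_j\cos\zeta}}{\big(1-\frac{\eta_j^2+\xi_j^2}{2\Lambda_j}\big)^2}\,\frac1{2\pi}\int_{\mathbb T}(\hat x^{(i)}\cdot\hat C^{(j)})^2d\lambda_i.$$ (c) For each $\Lambda$ with $\Lambda_i>0$ for all $i$, the planar part $f_{\rm pl}(\Lambda,\cdot)$, as a Hamiltonian with $n$ degrees of freedom on $\{(\eta,\xi)\in\mathbb R^{2n}:\frac{\eta_i^2+\xi_i^2}2<\Lambda_i\text{ for all }i\}$ with the form $\sum_i d\eta_i\wedge d\xi_i$, is smooth and Liouville integrable (it has $n$ smooth first integrals in involution that are independent on a dense open set), and it is in Birkhoff normal form: it is a real-analytic function of the actions $\frac{\eta_i^2+\xi_i^2}2$,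 $1\le i\le n$, alone. -/

import Mathlib

open scoped Matrix ContDiff

noncomputable section

namespace Planetary

/-- The Euclidean space `ℝ³`. -/
abbrev E3 := EuclideanSpace ℝ (Fin 3)

/-- The cross product on `ℝ³`. -/
def cross (u v : E3) : E3 := WithLp.toLp 2 (crossProduct (WithLp.ofLp u) (WithLp.ofLp v))

/-- The average over the circle `𝕋 = ℝ / 2πℤ` of a `2π`-periodic function of a real variable. -/
def circleAvg (f : ℝ → ℝ) : ℝ := (2 * Real.pi)⁻¹ * ∫ l in (0 : ℝ)..(2 * Real.pi), f l

/-! ### The planetary system -/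

/-- The data of the planetary `(1+n)`-body problem: the mass `mbar0` of the star and the masses
`μ * mbar i` of the `n` planets. -/
structure System (n : ℕ) where
  mbar0 : ℝ
  mbar : Fin n → ℝ
  μ : ℝ
  mbar0_pos : 0 < mbar0
  mbar_pos : ∀ i, 0 < mbar i
  μ_pos : 0 < μ

/-- The auxiliary mass `M_i` of the `i`-th two-body problem `|y|²/(2 m_i) - m_i M_i / |x|`. -/
def System.M {n : ℕ} (S : System n) (i : Fin n) : ℝ := S.mbar0 + S.μ * S.mbar i

/-- The reduced mass `m_i` of the `i`-th two-body problem `|y|²/(2 m_i) - m_i M_i / |x|`. -/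
def System.m {n : ℕ} (S : System n) (i : Fin n) : ℝ :=
  S.mbar0 * S.mbar i / (S.mbar0 + S.μ * S.mbar i)

/-! ### The RPS variables

The planets and all the variables are numbered from `0` to `n - 1`. For a state `(y, x)` let
`C i = x i × y i` be the angular momentum of planet `i`, let `S i = C 0 + ... + C i`, and let
`k₁, k₂, k₃` be the standard basis of `ℝ³`. For `u`, `v` orthogonal to `w` let `α_w (u, v)` be the
angle from `u` to `v`, oriented by `w`. With the nodes

  `ν i = S i × C i` for `1 ≤ i < n`,   `ν 0 = ν 1`,   `ν n = k₃ × S (n - 1)`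

and the angles

  `ψ i = α_{S i} (ν (i + 1), ν i)` for `1 ≤ i < n`,   `ψ n = α_{k₃} (k₁, ν n)`,
  `γ i = α_{C i} (ν i, perihelion of planet i)`,   `ℓ i = ` mean anomaly of planet `i`,
  `σ i = ψ i + ... + ψ n` for `1 ≤ i ≤ n`,   `σ 0 = σ 1`,

the RPS variables `(Λ, λ, η, ξ, p, q)` of the state are given by

  `Λ i = m i * √(M i * a i)`,   `λ i = ℓ i + γ i + σ i`,
  `η i =  √(2 (Λ i - ‖C i‖)) cos (γ i + σ i)`,
  `ξ i = -√(2 (Λ i - ‖C i‖)) sin (γ i + σ i)`,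
  `p i =  √(2 (‖C (i+1)‖ + ‖S i‖ - ‖S (i+1)‖)) cos (σ (i+1))`   for `i < n - 1`,
  `q i = -√(2 (‖C (i+1)‖ + ‖S i‖ - ‖S (i+1)‖)) sin (σ (i+1))`   for `i < n - 1`,

and, for `i = n - 1`, by the same formulae for `p i`, `q i` with the radicand
`2 (‖S (n-1)‖ - S (n-1) · k₃)`. What is defined below is the inverse map
`(Λ, λ, z) ↦ (y, x)`, which extends real-analytically to the points at which some nodes or some
eccentricities vanish (in particular to coplanar or circular motions). The angle `λ i` enters only
in the coordinates of planet `i` and is passed as a separate argument. -/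

/-- The variables `Λ` and `z = (η, ξ, p, q)`. -/
structure Point (n : ℕ) where
  Λ : Fin n → ℝ
  η : Fin n → ℝ
  ξ : Fin n → ℝ
  p : Fin n → ℝ
  q : Fin n → ℝ

section Elements

variable {n : ℕ} (z : Point n)

/-- The length of the angular momentum `C i` of planet `i`. -/
def Point.Gam (i : Fin n) : ℝ := z.Λ i - ((z.η i) ^ 2 + (z.ξ i) ^ 2) / 2

/-- The action of the couple `(p i, q i)`. -/
def Point.incl (i : Fin n) : ℝ := ((z.p i) ^ 2 + (z.q i) ^ 2) / 2

/-- The length of the partial sum `S i = C 0 + ... + C i` of the angular momenta. -/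
def Point.normS (i : Fin n) : ℝ :=
  ∑ k ∈ Finset.Iic i, z.Gam k - ∑ k ∈ Finset.Iio i, z.incl k

/-- The eccentricity of planet `i`, so that `‖C i‖ = Λ i * √(1 - e i ^ 2)`. -/
def Point.ecc (i : Fin n) : ℝ :=
  √(((z.η i) ^ 2 + (z.ξ i) ^ 2) / z.Λ i - (((z.η i) ^ 2 + (z.ξ i) ^ 2) / (2 * z.Λ i)) ^ 2)

/-- The predecessor of a planet (only used for planets other than planet `0`). -/
def prev (j : Fin n) : Fin n := ⟨j.val - 1, lt_of_le_of_lt (Nat.sub_le _ _) j.isLt⟩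

/-- The last index `n - 1`. -/
def lastOf (i : Fin n) : Fin n := ⟨n - 1, Nat.sub_lt i.pos Nat.one_pos⟩

end Elements

/-- The domain of regularity of the RPS variables: negative two-body energies, eccentricities
smaller than `1`, `S k` and `C (k + 1)` not antiparallel, and `S (n - 1)` not antiparallel to
the third axis. -/
def rpsDomain (n : ℕ) : Set (Point n) :=
  {z | (∀ i, 0 < z.Λ i) ∧ (∀ i, ((z.η i) ^ 2 + (z.ξ i) ^ 2) / 2 < z.Λ i) ∧
    (∀ k, z.incl k < 2 * z.normS k) ∧
    (∀ j : Fin n, 0 < j.val → z.incl (prev j) < 2 * z.Gam j)}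

/-- With `p = ρ cos σ`, `q = -ρ sin σ`, `c = (1 - cos ι) / ρ²`, `s = sin ι / ρ`: the rotation
by the angle `ι` about the axis `(cos σ, sin σ, 0)`. -/
def tiltMatrix (p q c s : ℝ) : Matrix (Fin 3) (Fin 3) ℝ :=
  !![1 - q ^ 2 * c, -(p * q * c), -(q * s);
     -(p * q * c), 1 - p ^ 2 * c, -(p * s);
     q * s, p * s, 1 - (p ^ 2 + q ^ 2) * c]

/-- The rotation by the angle `θ` about the third axis. -/
def rotZ (θ : ℝ) : Matrix (Fin 3) (Fin 3) ℝ :=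
  !![Real.cos θ, -Real.sin θ, 0; Real.sin θ, Real.cos θ, 0; 0, 0, 1]

section Frames

variable {n : ℕ} (z : Point n)

/-- `(1 - cos ι) / ρ²`, where `ι` is the angle between `S j` and `C j`, for `0 < j`. -/
def Point.cPlanet (j : Fin n) : ℝ :=
  (2 * z.normS (prev j) - z.incl (prev j)) / (4 * z.normS j * z.Gam j)

/-- `(1 - cos ι) / ρ²`, where `ι` is the angle between `S j` and `S (j - 1)`, for `0 < j`. -/
def Point.cPartial (j : Fin n) : ℝ :=
  (2 * z.Gam j - z.incl (prev j)) / (4 * z.normS j * z.normS (prev j))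

/-- The rotation about the node `S j × C j` that takes the direction of `S j` to that of `C j`. -/
def Point.rotPlanet (j : Fin n) : Matrix (Fin 3) (Fin 3) ℝ :=
  tiltMatrix (z.p (prev j)) (z.q (prev j)) (z.cPlanet j)
    (√(z.cPlanet j * (2 - 2 * z.incl (prev j) * z.cPlanet j)))

/-- The rotation about the node `S j × C j` that takes the direction of `S j` to that of
`S (j - 1)`. -/
def Point.rotPartial (j : Fin n) : Matrix (Fin 3) (Fin 3) ℝ :=
  tiltMatrix (z.p (prev j)) (z.q (prev j)) (z.cPartial j)
    (-√(z.cPartial j * (2 - 2 * z.incl (prev j) * z.cPartial j)))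

/-- The rotation about the node `k₃ × S N` that takes `k₃` to the direction of the total angular
momentum `S N`, where `N = n - 1`. -/
def Point.rotTotal (N : Fin n) : Matrix (Fin 3) (Fin 3) ℝ :=
  tiltMatrix (z.p N) (z.q N) (1 / (2 * z.normS N))
    (√(1 / (2 * z.normS N) * (2 - 2 * z.incl N * (1 / (2 * z.normS N)))))

/-- The product of the rotations that take `k₃` to the direction of `S (n - 1)`, then to the one
of `S (n - 2)`, and so on down to the direction of `S i`. -/
def Point.frameS (i : Fin n) : Matrix (Fin 3) (Fin 3) ℝ :=
  z.rotTotal (lastOf i) *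
    (((List.finRange n).filter (fun j => i < j)).reverse.map z.rotPartial).prod

/-- The orbital frame of planet `i`: its third axis is the direction of `C i`. -/
def Point.frame (i : Fin n) : Matrix (Fin 3) (Fin 3) ℝ :=
  if i.val = 0 then z.frameS i else z.frameS i * z.rotPlanet i

end Frames

/-- For `0 ≤ e < 1`, Kepler's equation `E - e sin E = l` has exactly one solution `E`. -/
theorem kepler_bijective {e : ℝ} (h0 : 0 ≤ e) (h1 : e < 1) :
    Function.Bijective (fun E : ℝ => E - e * Real.sin E) := by
  have hm : StrictMono (fun E : ℝ => E - e * Real.sin E) := by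
    apply strictMono_of_deriv_pos
    intro x
    have h : HasDerivAt (fun E : ℝ => E - e * Real.sin E) (1 - e * Real.cos x) x :=
      (hasDerivAt_id x).sub ((Real.hasDerivAt_sin x).const_mul e)
    rw [h.deriv]
    nlinarith [Real.cos_le_one x]
  refine ⟨hm.injective, ?_⟩
  have hc : Continuous (fun E : ℝ => E - e * Real.sin E) := by fun_prop
  apply hc.surjective
  · apply Filter.tendsto_atTop_mono (f := fun E : ℝ => E - 1)
    · intro x
      nlinarith [Real.sin_le_one x]
    · exact Filter.tendsto_atTop_add_const_right _ (-1) Filter.tendsto_id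
  · apply Filter.tendsto_atBot_mono (f := fun E : ℝ => E + 1)
    · intro x
      nlinarith [Real.neg_one_le_sin x]
    · exact Filter.tendsto_atBot_add_const_right _ 1 Filter.tendsto_id

/-- The eccentric anomaly `E` with mean anomaly `l`, that is, the solution of Kepler's equation
`E - e sin E = l` (unique for `0 ≤ e < 1`). -/
def eccAnomaly (e l : ℝ) : ℝ := Function.invFun (fun E : ℝ => E - e * Real.sin E) l

section CartesianMap

variable {n : ℕ} (S : System n) (z : Point n) (i : Fin n)

/-- The semi-major axis, so that `Λ i = m i * √(M i * a i)`. -/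
def semiAxis : ℝ := 1 / S.M i * (z.Λ i / S.m i) ^ 2

/-- The Keplerian frequency of planet `i`. -/
def meanMotion : ℝ := (S.M i) ^ 2 * (S.m i) ^ 3 / (z.Λ i) ^ 3

/-- The argument of `η i + ξ i * I`. It is the opposite of the longitude `γ i + σ i` of the
perihelion. -/
def argEcc : ℝ := Complex.arg ⟨z.η i, z.ξ i⟩

/-- The eccentric anomaly of planet `i` at `λ i = l`; the mean anomaly is `l + argEcc z i`. -/
def anomaly (l : ℝ) : ℝ := eccAnomaly (z.ecc i) (l + argEcc z i)

/-- The position `x i` of planet `i` at `λ i = l`. -/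
def position (l : ℝ) : E3 :=
  WithLp.toLp 2 ((z.frame i * rotZ (-argEcc z i)) *ᵥ
    ![semiAxis S z i * (Real.cos (anomaly z i l) - z.ecc i),
      semiAxis S z i * √(1 - (z.ecc i) ^ 2) * Real.sin (anomaly z i l), 0])

/-- The momentum `y i` of planet `i` at `λ i = l`: the mass `m i` times the velocity on the
Keplerian ellipse. -/
def momentum (l : ℝ) : E3 :=
  WithLp.toLp 2 ((z.frame i * rotZ (-argEcc z i)) *ᵥ
    ((S.m i * meanMotion S z i * semiAxis S z i / (1 - z.ecc i * Real.cos (anomaly z i l))) •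
      ![-Real.sin (anomaly z i l), √(1 - (z.ecc i) ^ 2) * Real.cos (anomaly z i l), 0]))

/-- The angular momentum `C i = x i × y i`, evaluated at `λ i = 0`. -/
def angMom : E3 := cross (position S z i 0) (momentum S z i 0)

end CartesianMap

/-! ### The secular perturbing function -/

section Secular

variable {n : ℕ} (S : System n) (z : Point n)

/-- The average over `(λ i, λ j)` of `1 / ‖ε x i - x j‖`. -/
def scaledAverage (i j : Fin n) (ε : ℝ) : ℝ :=
  circleAvg fun li => circleAvg fun lj => 1 / ‖ε • position S z i li - position S z j lj‖

/-- The term of order `k` in the expansion in powers of `a i / a j`, with `a j` fixed, of the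
average over `(λ i, λ j)` of `1 / ‖x i - x j‖`. -/
def fTerm (k : ℕ) (i j : Fin n) : ℝ :=
  1 / (k.factorial : ℝ) * iteratedDeriv k (scaledAverage S z i j) 0

/-- The second-order term of the secular perturbing function. -/
def secularTwo : ℝ :=
  -∑ i : Fin n, ∑ j ∈ Finset.Ioi i, S.mbar i * S.mbar j * fTerm S z 2 i j

/-- The common factor `(a i² / a j³) (2π)⁻¹ ∫ dζ / (1 - e_j cos ζ) / (1 - (η_j² + ξ_j²)/(2Λ_j))²`
of the planar and of the vertical part. -/
def coupling (i j : Fin n) : ℝ :=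
  (semiAxis S z i) ^ 2 / (semiAxis S z j) ^ 3 *
    (circleAvg (fun ζ => 1 / (1 - z.ecc j * Real.cos ζ)) /
      (1 - ((z.η j) ^ 2 + (z.ξ j) ^ 2) / (2 * z.Λ j)) ^ 2)

/-- The closed form of the vertical part. -/
def verticalFormula : ℝ :=
  3 / 4 * ∑ i : Fin n, ∑ j ∈ Finset.Ioi i, S.mbar i * S.mbar j * coupling S z i j *
    circleAvg fun l => (inner ℝ ((semiAxis S z i)⁻¹ • position S z i l)
      (‖angMom S z j‖⁻¹ • angMom S z j)) ^ 2

/-- The closed form of the planar part. -/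
def planarFormula : ℝ :=
  -(1 / 4) * ∑ i : Fin n, ∑ j ∈ Finset.Ioi i, S.mbar i * S.mbar j * coupling S z i j *
    (1 + 3 / 2 * (z.ecc i) ^ 2)

end Secular

/-- The planar secular phase space, with the coordinates `w = (η, ξ)`. -/
abbrev PlanarSpace (n : ℕ) := (Fin n → ℝ) × (Fin n → ℝ)

/-- The point with `p = q = 0`, that is, coplanar motions in the plane of the first two axes. -/
def planarPoint {n : ℕ} (Λ : Fin n → ℝ) (w : PlanarSpace n) : Point n :=
  ⟨Λ, w.1, w.2, 0, 0⟩

/-- The planar part of the second-order term of the secular perturbing function: the term that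
one has for the problem in the plane. -/
def planarPart {n : ℕ} (S : System n) (Λ : Fin n → ℝ) (w : PlanarSpace n) : ℝ :=
  secularTwo S (planarPoint Λ w)

/-- The planar secular domain. -/
def planarDomain {n : ℕ} (Λ : Fin n → ℝ) : Set (PlanarSpace n) :=
  {w | ∀ i, ((w.1 i) ^ 2 + (w.2 i) ^ 2) / 2 < Λ i}

/-! ### Integrability and Birkhoff normal form -/

/-- The actions `(η_i² + ξ_i²) / 2`. -/
def actions {n : ℕ} (w : PlanarSpace n) : Fin n → ℝ :=
  fun i => ((w.1 i) ^ 2 + (w.2 i) ^ 2) / 2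

/-- The Poisson bracket of the symplectic form `∑ dη_i ∧ dξ_i`. -/
def poisson {n : ℕ} (F G : PlanarSpace n → ℝ) (w : PlanarSpace n) : ℝ :=
  ∑ i : Fin n, (fderiv ℝ F w (Pi.single i 1, 0) * fderiv ℝ G w (0, Pi.single i 1) -
    fderiv ℝ F w (0, Pi.single i 1) * fderiv ℝ G w (Pi.single i 1, 0))

/-- Integrability in the sense of Liouville of a smooth Hamiltonian with `n` degrees of freedom
on the open set `U`: there are `n` smooth first integrals in involution, independent on a dense
open subset of `U`. -/
def LiouvilleIntegrable {n : ℕ} (H : PlanarSpace n → ℝ) (U : Set (PlanarSpace n)) : Prop :=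
  ContDiffOn ℝ ∞ H U ∧
  ∃ K : Fin n → PlanarSpace n → ℝ,
    (∀ i, ContDiffOn ℝ ∞ (K i) U) ∧
    (∀ i, ∀ w ∈ U, poisson H (K i) w = 0) ∧
    (∀ i j, ∀ w ∈ U, poisson (K i) (K j) w = 0) ∧
    ∃ V ⊆ U, IsOpen V ∧ U ⊆ closure V ∧
      ∀ w ∈ V, LinearIndependent ℝ (fun i => fderiv ℝ (K i) w)

/-- `H` is in (convergent) Birkhoff normal form on `U`: it is a real-analytic function of the
actions `(η_i² + ξ_i²) / 2` alone. -/
def InBirkhoffNormalForm {n : ℕ} (H : PlanarSpace n → ℝ) (U : Set (PlanarSpace n)) : Prop :=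
  ∃ g : (Fin n → ℝ) → ℝ, AnalyticOnNhd ℝ g (actions '' U) ∧ ∀ w ∈ U, H w = g (actions w)

end Planetary

end

/-!
The positions of the planets are the images under rotations of points on plane Keplerian ellipses:
on the domain of the variables every tilt matrix is a rotation (`tilt_radicand` is the inequality
behind this), hence so are the orbital frames (`Point.frame_mem`). Rotations preserve inner and
cross products, so that the angular momentum of planet `j` is its length `Λ_j √(1 - e_j²)` times the
third axis of its frame (`cross_position_momentum`).

Since `‖x i‖` is bounded above and `‖x j‖` is bounded away from zero, the averaged interaction can
be differentiated under the integral sign near `ε = 0` (`contDiffAt_averaged_newton`). The second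
derivative at `0` is the double average of the quadrupole
`(3 (x i · x j)² - ‖x i‖² ‖x j‖²) / ‖x j‖⁵`. The key point is that its average over the motion of
planet `j` is elementary (`circleAvg_quadrupole`): with respect to the true anomaly `v` it is the
integral of a quadratic form in `(cos v, sin v)` times `1 + e cos v`, in which the summand
`e cos v` contributes nothing by parity. What is left is half the trace of the form, a multiple
of `‖x i‖² - 3 (x i · Ĉ j)²`, where `Ĉ j` is the direction of the angular momentum of planet `j`.
The integrals are evaluated with explicit antiderivatives in terms of `cos v`, `sin v` and `v`, as
functions of the eccentric anomaly.

Averaging over the motion of planet `i`, the term `‖x i‖²` gives `a_i² (1 + 3/2 e_i²)`, the planar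
part, and the term `(x i · Ĉ j)²` gives the vertical part, which vanishes for coplanar motions.
As `(2π)⁻¹ ∫ dζ / (1 - e cos ζ) = 1 / √(1 - e²)` and `√(1 - e_j²) = 1 - I_j / Λ_j` with
`I_j = (η_j² + ξ_j²) / 2`, the planar part is an explicit rational function of the actions
(`planarNormalForm`). Functions of the actions are in involution, and the actions are independent
where no `η_i` vanishes (`liouvilleIntegrable_of_actions`).
-/

noncomputable section

namespace Planetary

/-! ### Rotations and orbital frames -/

/-- The condition says that `sin² ι + cos² ι = 1` for the angle `ι` of the tilt. -/
theorem tiltMatrix_mem_specialOrthogonalGroup {p q c s : ℝ}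
    (h : s ^ 2 = c * (2 - (p ^ 2 + q ^ 2) * c)) :
    tiltMatrix p q c s ∈ Matrix.specialOrthogonalGroup (Fin 3) ℝ := by
  rw [Matrix.mem_specialOrthogonalGroup_iff, Matrix.mem_orthogonalGroup_iff]
  constructor
  · ext i j
    fin_cases i <;> fin_cases j <;>
      simp [tiltMatrix, Matrix.mul_apply, Fin.sum_univ_three] <;>
      first
        | linear_combination h * p ^ 2
        | linear_combination h * q ^ 2
        | linear_combination h * (p * q)
        | linear_combination h * (p ^ 2 + q ^ 2)
        | ring
  · simp [tiltMatrix, Matrix.det_fin_three]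
    linear_combination h * (p ^ 2 + q ^ 2)

theorem rotZ_mem_specialOrthogonalGroup (θ : ℝ) :
    rotZ θ ∈ Matrix.specialOrthogonalGroup (Fin 3) ℝ := by
  have h := Real.sin_sq_add_cos_sq θ
  rw [Matrix.mem_specialOrthogonalGroup_iff, Matrix.mem_orthogonalGroup_iff]
  constructor
  · ext i j
    fin_cases i <;> fin_cases j <;>
      simp [rotZ, Matrix.mul_apply, Fin.sum_univ_three] <;>
      first
        | linear_combination h
        | ring
  · simp [rotZ, Matrix.det_fin_three]
    linear_combination h

theorem inner_toLp_mulVec {A : Matrix (Fin 3) (Fin 3) ℝ}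
    (hA : A ∈ Matrix.specialOrthogonalGroup (Fin 3) ℝ) (v w : Fin 3 → ℝ) :
    inner ℝ (WithLp.toLp 2 (A *ᵥ v) : E3) (WithLp.toLp 2 (A *ᵥ w)) = v ⬝ᵥ w := by
  have h : Aᵀ * A = 1 := (Matrix.mem_orthogonalGroup_iff' ..).1
    ((Matrix.mem_specialOrthogonalGroup_iff ..).1 hA).1
  simp only [EuclideanSpace.inner_toLp_toLp, star_trivial]
  rw [Matrix.dotProduct_mulVec, Matrix.vecMul_mulVec, h, Matrix.vecMul_one, dotProduct_comm]

theorem norm_sq_toLp_mulVec {A : Matrix (Fin 3) (Fin 3) ℝ}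
    (hA : A ∈ Matrix.specialOrthogonalGroup (Fin 3) ℝ) (v : Fin 3 → ℝ) :
    ‖(WithLp.toLp 2 (A *ᵥ v) : E3)‖ ^ 2 = v ⬝ᵥ v := by
  rw [← real_inner_self_eq_norm_sq, inner_toLp_mulVec hA]

/-- Rotations commute with the cross product, since a rotation is its own cofactor matrix. -/
theorem cross_toLp_mulVec {A : Matrix (Fin 3) (Fin 3) ℝ}
    (hA : A ∈ Matrix.specialOrthogonalGroup (Fin 3) ℝ) (v w : Fin 3 → ℝ) :
    cross (WithLp.toLp 2 (A *ᵥ v)) (WithLp.toLp 2 (A *ᵥ w)) =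
      WithLp.toLp 2 (A *ᵥ (crossProduct v w)) := by
  obtain ⟨h1, h2⟩ := (Matrix.mem_specialOrthogonalGroup_iff ..).1 hA
  have h1' : Aᵀ * A = 1 := (Matrix.mem_orthogonalGroup_iff' ..).1 h1
  have h3 : A.adjugate = Aᵀ := by
    have := A.mul_adjugate
    rw [h2, one_smul] at this
    calc A.adjugate = (Aᵀ * A) * A.adjugate := by rw [h1', one_mul]
      _ = Aᵀ := by rw [mul_assoc, this, mul_one]
  have h4 : A = A.adjugateᵀ := by rw [h3, Matrix.transpose_transpose]
  unfold cross
  congr 1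
  conv_rhs => rw [h4]
  rw [Matrix.adjugate_fin_three]
  ext i
  fin_cases i <;>
    simp [cross_apply, Matrix.mulVec, dotProduct, Fin.sum_univ_three] <;> ring

section Frames

variable {n : ℕ} {z : Point n}

theorem Point.incl_nonneg (z : Point n) (i : Fin n) : 0 ≤ z.incl i := by
  unfold Point.incl; positivity

theorem Point.Gam_pos (hz : z ∈ rpsDomain n) (i : Fin n) : 0 < z.Gam i := by
  have := hz.2.1 i
  unfold Point.Gam; linarith

theorem Point.normS_pos (hz : z ∈ rpsDomain n) (i : Fin n) : 0 < z.normS i := by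
  have h1 := hz.2.2.1 i
  have h2 := z.incl_nonneg i
  linarith

theorem Point.normS_eq_prev (z : Point n) {j : Fin n} (hj : 0 < j.val) :
    z.normS j = z.normS (prev j) + z.Gam j - z.incl (prev j) := by
  have h1 : Finset.Iic j = insert j (Finset.Iic (prev j)) := by
    ext k; simp only [Finset.mem_Iic, Finset.mem_insert, Fin.le_def, Fin.ext_iff, prev]; omega
  have h2 : Finset.Iio j = insert (prev j) (Finset.Iio (prev j)) := by
    ext k
    simp only [Finset.mem_Iio, Finset.mem_insert, Fin.lt_def, Fin.ext_iff, prev]; omega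
  have h3 : j ∉ Finset.Iic (prev j) := by
    simp only [Finset.mem_Iic, Fin.le_def, prev]; omega
  unfold Point.normS
  rw [h1, h2, Finset.sum_insert h3, Finset.sum_insert (by simp)]
  ring

/-- The radicand that gives the sine of the inclination is nonnegative. With `s = ‖S‖` and
`g = ‖C‖` the lengths of two vectors whose sum has length `s + g - I`, this says that the cosine
of the angle between the sum and the second vector lies between `-1` and `1`. -/
theorem tilt_radicand {s g I c : ℝ} (hI : 0 ≤ I) (hs : I < 2 * s) (hg : I < 2 * g)
    (hc : c = (2 * s - I) / (4 * (s + g - I) * g)) : 0 ≤ c * (2 - 2 * I * c) := by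
  have hg0 : 0 < g := by linarith
  have h0 : 0 < s + g - I := by linarith
  have hc0 : 0 ≤ c := by rw [hc]; apply div_nonneg <;> [linarith; positivity]
  apply mul_nonneg hc0
  have : 2 * I * c ≤ 2 := by
    rw [hc, mul_div_assoc', div_le_iff₀ (by positivity)]
    nlinarith [mul_pos (show 0 < 2 * s by linarith) (show 0 < 2 * g - I by linarith),
      sq_nonneg (2 * g - I)]
  linarith

theorem Point.rotPlanet_mem (hz : z ∈ rpsDomain n) {j : Fin n} (hj : 0 < j.val) :
    z.rotPlanet j ∈ Matrix.specialOrthogonalGroup (Fin 3) ℝ := by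
  have h := tilt_radicand (c := z.cPlanet j) (z.incl_nonneg (prev j)) (hz.2.2.1 (prev j))
    (hz.2.2.2 j hj) (by rw [Point.cPlanet, z.normS_eq_prev hj])
  apply tiltMatrix_mem_specialOrthogonalGroup
  rw [Real.sq_sqrt h, Point.incl]; ring

theorem Point.rotPartial_mem (hz : z ∈ rpsDomain n) {j : Fin n} (hj : 0 < j.val) :
    z.rotPartial j ∈ Matrix.specialOrthogonalGroup (Fin 3) ℝ := by
  have h := tilt_radicand (c := z.cPartial j) (z.incl_nonneg (prev j)) (hz.2.2.2 j hj)
    (hz.2.2.1 (prev j)) (by rw [Point.cPartial, z.normS_eq_prev hj, add_comm (z.Gam j)])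
  apply tiltMatrix_mem_specialOrthogonalGroup
  rw [neg_sq, Real.sq_sqrt h, Point.incl]; ring

theorem Point.rotTotal_mem (hz : z ∈ rpsDomain n) (N : Fin n) :
    z.rotTotal N ∈ Matrix.specialOrthogonalGroup (Fin 3) ℝ := by
  have h0 := Point.normS_pos hz N
  have h : 0 ≤ 1 / (2 * z.normS N) * (2 - 2 * z.incl N * (1 / (2 * z.normS N))) := by
    apply mul_nonneg (by positivity)
    have h1 := hz.2.2.1 N
    have : 2 * z.incl N * (1 / (2 * z.normS N)) ≤ 2 := by
      rw [mul_one_div, div_le_iff₀ (by positivity)]; linarith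
    linarith
  apply tiltMatrix_mem_specialOrthogonalGroup
  rw [Real.sq_sqrt h, Point.incl]; ring

theorem Point.frameS_mem (hz : z ∈ rpsDomain n) (i : Fin n) :
    z.frameS i ∈ Matrix.specialOrthogonalGroup (Fin 3) ℝ := by
  refine mul_mem (Point.rotTotal_mem hz _) (Submonoid.list_prod_mem _ ?_)
  intro A hA
  simp only [List.mem_map, List.mem_reverse, List.mem_filter, decide_eq_true_eq] at hA
  obtain ⟨j, ⟨-, hj⟩, rfl⟩ := hA
  exact Point.rotPartial_mem hz (lt_of_le_of_lt (Nat.zero_le _) hj)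

theorem Point.frame_mem (hz : z ∈ rpsDomain n) (i : Fin n) :
    z.frame i ∈ Matrix.specialOrthogonalGroup (Fin 3) ℝ := by
  unfold Point.frame
  split_ifs with h
  · exact Point.frameS_mem hz i
  · exact mul_mem (Point.frameS_mem hz i) (Point.rotPlanet_mem hz (Nat.pos_of_ne_zero h))

/-- For coplanar motions in the horizontal plane all the orbital frames are the standard one. -/
theorem frame_planarPoint (Λ : Fin n → ℝ) (w : PlanarSpace n) (i : Fin n) :
    (planarPoint Λ w).frame i = 1 := by
  have h0 : ∀ c s, tiltMatrix 0 0 c s = 1 := by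
    intro c s
    ext i j
    fin_cases i <;> fin_cases j <;> simp [tiltMatrix]
  have hp : ∀ k, (planarPoint Λ w).p k = 0 := fun _ => rfl
  have hq : ∀ k, (planarPoint Λ w).q k = 0 := fun _ => rfl
  have hS : (planarPoint Λ w).frameS i = 1 := by
    simp only [Point.frameS, Point.rotTotal, hp, hq, h0, one_mul]
    apply List.prod_eq_one
    intro A hA
    simp only [List.mem_map] at hA
    obtain ⟨j, -, rfl⟩ := hA
    simp only [Point.rotPartial, hp, hq, h0]
  simp only [Point.frame, hS, Point.rotPlanet, hp, hq, h0, mul_one, ite_self]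

theorem planarPoint_mem_rpsDomain {Λ : Fin n → ℝ} (hΛ : ∀ i, 0 < Λ i) {w : PlanarSpace n}
    (hw : w ∈ planarDomain Λ) : planarPoint Λ w ∈ rpsDomain n := by
  have hG : ∀ k, 0 < (planarPoint Λ w).Gam k := fun k => sub_pos.2 (hw k)
  have hI : ∀ k, (planarPoint Λ w).incl k = 0 := fun k => by simp [Point.incl, planarPoint]
  refine ⟨hΛ, hw, fun k => ?_, fun j _ => ?_⟩
  · simp only [Point.normS, hI, Finset.sum_const_zero, sub_zero]
    exact mul_pos two_pos (Finset.sum_pos (fun k _ => hG k) ⟨k, by simp⟩)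
  · rw [hI]; exact mul_pos two_pos (hG j)

end Frames

/-! ### Averages over the circle -/

theorem circleAvg_const (c : ℝ) : circleAvg (fun _ => c) = c := by
  simp only [circleAvg, intervalIntegral.integral_const, smul_eq_mul, sub_zero]
  field_simp

theorem circleAvg_const_mul (c : ℝ) (f : ℝ → ℝ) :
    circleAvg (fun l => c * f l) = c * circleAvg f := by
  simp only [circleAvg, intervalIntegral.integral_const_mul]; ring

theorem circleAvg_sub {f g : ℝ → ℝ} (hf : Continuous f) (hg : Continuous g) :
    circleAvg (fun l => f l - g l) = circleAvg f - circleAvg g := by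
  simp only [circleAvg]
  rw [intervalIntegral.integral_sub (hf.intervalIntegrable _ _) (hg.intervalIntegrable _ _)]
  ring

theorem circleAvg_eq_of_hasDerivAt {F f : ℝ → ℝ} (h : ∀ x, HasDerivAt F (f x) x)
    (hf : Continuous f) : circleAvg f = (2 * Real.pi)⁻¹ * (F (2 * Real.pi) - F 0) := by
  rw [circleAvg, intervalIntegral.integral_eq_sub_of_hasDerivAt (fun x _ => h x)
    (hf.intervalIntegrable _ _)]

/-! ### Kepler's equation -/

section Kepler

variable {e : ℝ}

theorem one_sub_mul_cos_pos (h0 : 0 ≤ e) (h1 : e < 1) (E : ℝ) : 0 < 1 - e * Real.cos E := by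
  nlinarith [Real.cos_le_one E]

theorem eccAnomaly_spec (h0 : 0 ≤ e) (h1 : e < 1) (l : ℝ) :
    eccAnomaly e l - e * Real.sin (eccAnomaly e l) = l :=
  Function.rightInverse_invFun (kepler_bijective h0 h1).2 l

theorem eccAnomaly_apply (h0 : 0 ≤ e) (h1 : e < 1) (E : ℝ) :
    eccAnomaly e (E - e * Real.sin E) = E :=
  Function.leftInverse_invFun (kepler_bijective h0 h1).1 E

theorem hasDerivAt_kepler (e E : ℝ) :
    HasDerivAt (fun E => E - e * Real.sin E) (1 - e * Real.cos E) E :=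
  (hasDerivAt_id E).sub ((Real.hasDerivAt_sin E).const_mul e)

theorem continuous_eccAnomaly (h0 : 0 ≤ e) (h1 : e < 1) : Continuous (eccAnomaly e) := by
  have hm : StrictMono (fun E : ℝ => E - e * Real.sin E) := by
    apply strictMono_of_deriv_pos
    intro x
    rw [(hasDerivAt_kepler e x).deriv]
    exact one_sub_mul_cos_pos h0 h1 x
  apply Monotone.continuous_of_surjective
  · intro l l' hl
    rw [← hm.le_iff_le]
    simpa only [eccAnomaly_spec h0 h1] using hl
  · exact fun E => ⟨_, eccAnomaly_apply h0 h1 E⟩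

/-- Averages over the mean anomaly become averages over the eccentric anomaly `E`, with the
density `1 - e cos E`. -/
theorem circleAvg_eccAnomaly (h0 : 0 ≤ e) (h1 : e < 1) (θ : ℝ) {g : ℝ → ℝ} (hg : Continuous g)
    (hp : Function.Periodic g (2 * Real.pi)) :
    circleAvg (fun l => g (eccAnomaly e (l + θ))) =
      circleAvg (fun E => g E * (1 - e * Real.cos E)) := by
  have hper : Function.Periodic (fun E => g E * (1 - e * Real.cos E)) (2 * Real.pi) := by
    intro E
    simp only [hp E, Real.cos_add_two_pi]
  have hE := eccAnomaly_spec h0 h1 θ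
  set E₀ := eccAnomaly e θ with hE₀
  -- substitution `l = E - e sin E - θ`, which maps the period that starts at `E₀` to `[0, 2π]`
  have key := intervalIntegral.integral_comp_mul_deriv (a := E₀) (b := E₀ + 2 * Real.pi)
    (f := fun E => E - e * Real.sin E - θ) (f' := fun E => 1 - e * Real.cos E)
    (g := fun l => g (eccAnomaly e (l + θ)))
    (fun E _ => (hasDerivAt_kepler e E).sub_const θ) (by fun_prop)
    (hg.comp ((continuous_eccAnomaly h0 h1).comp (by fun_prop)))
  simp only [Function.comp_def, sub_add_cancel, eccAnomaly_apply h0 h1, Real.sin_add_two_pi] at key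
  unfold circleAvg
  have hl : E₀ - e * Real.sin E₀ - θ = 0 := by linarith
  have hr : E₀ + 2 * Real.pi - e * Real.sin E₀ - θ = 2 * Real.pi := by linarith
  rw [hl, hr] at key
  rw [← key, hper.intervalIntegral_add_eq E₀ 0, zero_add]

/-- The cosine of the true anomaly. -/
def cosTrue (e E : ℝ) : ℝ := (Real.cos E - e) / (1 - e * Real.cos E)

/-- The sine of the true anomaly. -/
def sinTrue (e E : ℝ) : ℝ := √(1 - e ^ 2) * Real.sin E / (1 - e * Real.cos E)

/-- The true anomaly as a function of the eccentric anomaly. The formula, with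
`β = e / (1 + √(1 - e²))`, is valid on the whole real line, unlike the one for the tangent of the
half angles. -/
def trueAnomaly (e E : ℝ) : ℝ :=
  E + 2 * Real.arctan (e / (1 + √(1 - e ^ 2)) * Real.sin E /
    (1 - e / (1 + √(1 - e ^ 2)) * Real.cos E))

theorem one_sub_sq_pos (h0 : 0 ≤ e) (h1 : e < 1) : 0 < 1 - e ^ 2 := by nlinarith

theorem hasDerivAt_trueAnomaly (h0 : 0 ≤ e) (h1 : e < 1) (E : ℝ) :
    HasDerivAt (trueAnomaly e) (√(1 - e ^ 2) / (1 - e * Real.cos E)) E := by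
  have hb := Real.sqrt_pos.2 (one_sub_sq_pos h0 h1)
  have hb2 := Real.sq_sqrt (one_sub_sq_pos h0 h1).le
  unfold trueAnomaly
  set b := √(1 - e ^ 2)
  set β := e / (1 + b) with hβ
  have hβe : β * (1 + b) = e := by rw [hβ]; field_simp
  have hβ0 : 0 ≤ β := by positivity
  have hβ1 : β < 1 := by rw [hβ, div_lt_one (by positivity)]; linarith
  have hD := one_sub_mul_cos_pos hβ0 hβ1 E
  have hD' := one_sub_mul_cos_pos h0 h1 E
  have hsc := Real.sin_sq_add_cos_sq E
  have h := (hasDerivAt_id E).add ((((Real.hasDerivAt_sin E).const_mul β).div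
    (((Real.hasDerivAt_cos E).const_mul β).const_sub 1) hD.ne').arctan.const_mul 2)
  refine h.congr_deriv ?_
  have hpos : 0 < (1 - β * Real.cos E) ^ 2 + (β * Real.sin E) ^ 2 := by positivity
  -- together with `hβe` this expresses `e = 2β / (1 + β²)` and `b = (1 - β²) / (1 + β²)`
  have hq : β ^ 2 * (1 + b) = 1 - b := by
    have : (β * (1 + b)) ^ 2 = 1 - b ^ 2 := by rw [hβe]; linarith
    have h2 : (1 + b) * (β ^ 2 * (1 + b)) = (1 + b) * (1 - b) := by linarith
    exact mul_left_cancel₀ (by positivity) h2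
  have e1 : 1 + (β * Real.sin E / (1 - β * Real.cos E)) ^ 2 =
      ((1 - β * Real.cos E) ^ 2 + (β * Real.sin E) ^ 2) / (1 - β * Real.cos E) ^ 2 := by
    field_simp
  have e2 : β * Real.cos E * (1 - β * Real.cos E) - β * Real.sin E * -(β * -Real.sin E) =
      β * Real.cos E - β ^ 2 := by linear_combination (-β ^ 2) * hsc
  have e3 : (1 - β * Real.cos E) ^ 2 + (β * Real.sin E) ^ 2 = 1 - 2 * β * Real.cos E + β ^ 2 := by
    linear_combination β ^ 2 * hsc
  rw [Pi.div_apply, e1, e2, eq_div_iff hD'.ne', e3]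
  rw [e3] at hpos
  rw [← hβe]
  field_simp
  linear_combination (-(1 - Real.cos E * β)) * hq

theorem hasDerivAt_cosTrue (h0 : 0 ≤ e) (h1 : e < 1) (E : ℝ) :
    HasDerivAt (cosTrue e) (-sinTrue e E * (√(1 - e ^ 2) / (1 - e * Real.cos E))) E := by
  have hb2 := Real.sq_sqrt (one_sub_sq_pos h0 h1).le
  have hD := one_sub_mul_cos_pos h0 h1 E
  have h := ((Real.hasDerivAt_cos E).sub_const e).div
    (((Real.hasDerivAt_cos E).const_mul e).const_sub 1) hD.ne'
  refine h.congr_deriv ?_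
  rw [sinTrue]
  field_simp
  rw [hb2]; ring

theorem hasDerivAt_sinTrue (h0 : 0 ≤ e) (h1 : e < 1) (E : ℝ) :
    HasDerivAt (sinTrue e) (cosTrue e E * (√(1 - e ^ 2) / (1 - e * Real.cos E))) E := by
  have hD := one_sub_mul_cos_pos h0 h1 E
  have h := ((Real.hasDerivAt_sin E).const_mul √(1 - e ^ 2)).div
    (((Real.hasDerivAt_cos E).const_mul e).const_sub 1) hD.ne'
  refine h.congr_deriv ?_
  rw [cosTrue]
  field_simp
  linear_combination (-e * √(1 - e ^ 2)) * Real.sin_sq_add_cos_sq E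

theorem cosTrue_sq_add_sinTrue_sq (h0 : 0 ≤ e) (h1 : e < 1) (E : ℝ) :
    cosTrue e E ^ 2 + sinTrue e E ^ 2 = 1 := by
  have hb2 := Real.sq_sqrt (one_sub_sq_pos h0 h1).le
  have hD := one_sub_mul_cos_pos h0 h1 E
  rw [cosTrue, sinTrue, div_pow, div_pow, mul_pow, hb2, ← add_div,
    div_eq_one_iff_eq (by positivity)]
  linear_combination (1 - e ^ 2) * Real.sin_sq_add_cos_sq E

/-- The equation of the ellipse in polar coordinates, `r (1 + e cos v) = a (1 - e²)`. -/
theorem one_add_mul_cosTrue (h0 : 0 ≤ e) (h1 : e < 1) (E : ℝ) :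
    1 / (1 - e * Real.cos E) = (1 + e * cosTrue e E) / √(1 - e ^ 2) ^ 2 := by
  have hb2 := Real.sq_sqrt (one_sub_sq_pos h0 h1).le
  have hD := one_sub_mul_cos_pos h0 h1 E
  have := one_sub_sq_pos h0 h1
  rw [hb2, cosTrue]
  field_simp
  ring

theorem trueAnomaly_two_pi (e : ℝ) :
    trueAnomaly e (2 * Real.pi) - trueAnomaly e 0 = 2 * Real.pi := by
  simp [trueAnomaly]

theorem circleAvg_inv_one_sub_mul_cos (h0 : 0 ≤ e) (h1 : e < 1) :
    circleAvg (fun E => 1 / (1 - e * Real.cos E)) = 1 / √(1 - e ^ 2) := by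
  have hb := Real.sqrt_pos.2 (one_sub_sq_pos h0 h1)
  have h := circleAvg_eq_of_hasDerivAt (hasDerivAt_trueAnomaly h0 h1)
    (Continuous.div (by fun_prop) (by fun_prop) fun E => (one_sub_mul_cos_pos h0 h1 E).ne')
  have h2 : (fun E => √(1 - e ^ 2) / (1 - e * Real.cos E)) =
    fun E => √(1 - e ^ 2) * (1 / (1 - e * Real.cos E)) := by ext; rw [mul_one_div]
  rw [trueAnomaly_two_pi, h2, circleAvg_const_mul, inv_mul_cancel₀ (by positivity)] at h
  rw [eq_div_iff hb.ne', mul_comm, h]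

/-- The average over a Keplerian ellipse with semi-major axis `1` of the quadrupole
`(3 (w · r̂)² - W) / r³`, for a vector with the components `w₀`, `w₁` in the plane of the ellipse and
the squared length `W`, in terms of the eccentric anomaly. In terms of the true anomaly `v` it is,
up to a constant factor, the integral of the trigonometric polynomial
`(3 (w₀ cos v + w₁ sin v)² - W) (1 + e cos v)`. -/
theorem circleAvg_quadrupole (h0 : 0 ≤ e) (h1 : e < 1) (w₀ w₁ W : ℝ) :
    circleAvg (fun E => (3 * (w₀ * (Real.cos E - e) + w₁ * (√(1 - e ^ 2) * Real.sin E)) ^ 2 /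
      (1 - e * Real.cos E) ^ 2 - W) / (1 - e * Real.cos E) ^ 2) =
      (3 / 2 * (w₀ ^ 2 + w₁ ^ 2) - W) / √(1 - e ^ 2) ^ 3 := by
  have hb := Real.sqrt_pos.2 (one_sub_sq_pos h0 h1)
  set b := √(1 - e ^ 2) with hbdef
  have hd : ∀ E, HasDerivAt (fun E => (3 * w₀ ^ 2 * (trueAnomaly e E / 2 +
        cosTrue e E * sinTrue e E / 2 + e * (sinTrue e E - sinTrue e E ^ 3 / 3)) +
      6 * w₀ * w₁ * (sinTrue e E ^ 2 / 2 - e * (cosTrue e E ^ 3 / 3)) +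
      3 * w₁ ^ 2 * (trueAnomaly e E / 2 - cosTrue e E * sinTrue e E / 2 +
        e * (sinTrue e E ^ 3 / 3)) - W * (trueAnomaly e E + e * sinTrue e E)) / b ^ 3)
      ((3 * (w₀ * (Real.cos E - e) + w₁ * (b * Real.sin E)) ^ 2 /
      (1 - e * Real.cos E) ^ 2 - W) / (1 - e * Real.cos E) ^ 2) E := by
    intro E
    have hD := one_sub_mul_cos_pos h0 h1 E
    have hv := hasDerivAt_trueAnomaly h0 h1 E
    have hJ := hasDerivAt_cosTrue h0 h1 E
    have hK := hasDerivAt_sinTrue h0 h1 E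
    rw [← hbdef] at hv hJ hK
    have h := ((((((hv.div_const 2).add ((hJ.mul hK).div_const 2)).add
        ((hK.sub ((hK.pow 3).div_const 3)).const_mul e)).const_mul (3 * w₀ ^ 2)).add
      ((((hK.pow 2).div_const 2).sub (((hJ.pow 3).div_const 3).const_mul e)).const_mul
        (6 * w₀ * w₁))).add
      ((((hv.div_const 2).sub ((hJ.mul hK).div_const 2)).add
        (((hK.pow 3).div_const 3).const_mul e)).const_mul (3 * w₁ ^ 2))).sub
      ((hv.add (hK.const_mul e)).const_mul W) |>.div_const (b ^ 3)
    refine h.congr_deriv ?_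
    have hpol := one_add_mul_cosTrue h0 h1 E
    have hsq := cosTrue_sq_add_sinTrue_sq h0 h1 E
    rw [← hbdef] at hpol
    have ht : (3 * (w₀ * (Real.cos E - e) + w₁ * (b * Real.sin E)) ^ 2 /
      (1 - e * Real.cos E) ^ 2 - W) / (1 - e * Real.cos E) ^ 2 =
      (3 * (w₀ * cosTrue e E + w₁ * sinTrue e E) ^ 2 - W) *
        (1 / (1 - e * Real.cos E)) * (1 / (1 - e * Real.cos E)) := by
      rw [cosTrue, sinTrue, ← hbdef]; field_simp
    rw [ht, div_eq_mul_one_div b, hpol]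
    generalize cosTrue e E = J at *
    generalize sinTrue e E = K at *
    field_simp
    push_cast
    linear_combination -(1 + e * J) * ((9 + 18 * e * J) * w₀ ^ 2 + 9 * w₁ ^ 2) * hsq
  rw [circleAvg_eq_of_hasDerivAt hd]
  · have ht := trueAnomaly_two_pi e
    have hJ : cosTrue e (2 * Real.pi) = cosTrue e 0 := by simp [cosTrue]
    have hK : sinTrue e (2 * Real.pi) = sinTrue e 0 := by simp [sinTrue]
    have hv : trueAnomaly e (2 * Real.pi) = trueAnomaly e 0 + 2 * Real.pi := by linarith
    rw [hv, hJ, hK]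
    field_simp
    ring
  · have : ∀ E, (1 - e * Real.cos E) ^ 2 ≠ 0 :=
      fun E => pow_ne_zero 2 (one_sub_mul_cos_pos h0 h1 E).ne'
    fun_prop (disch := exact this)

theorem circleAvg_one_sub_mul_cos_pow_three (e : ℝ) :
    circleAvg (fun E => (1 - e * Real.cos E) ^ 3) = 1 + 3 / 2 * e ^ 2 := by
  have hd : ∀ E, HasDerivAt (fun E => E - 3 * e * Real.sin E +
      3 / 2 * e ^ 2 * (E + Real.sin E * Real.cos E) -
      e ^ 3 * (Real.sin E - Real.sin E ^ 3 / 3)) ((1 - e * Real.cos E) ^ 3) E := by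
    intro E
    have hs := Real.hasDerivAt_sin E
    have hc := Real.hasDerivAt_cos E
    have h := (((hasDerivAt_id E).sub (hs.const_mul (3 * e))).add
      (((hasDerivAt_id E).add (hs.mul hc)).const_mul (3 / 2 * e ^ 2))).sub
      ((hs.sub ((hs.pow 3).div_const 3)).const_mul (e ^ 3))
    refine h.congr_deriv ?_
    have hsc := Real.sin_sq_add_cos_sq E
    have hs : Real.sin E ^ 2 = 1 - Real.cos E ^ 2 := by linarith
    push_cast
    linear_combination (-(3 / 2 * e ^ 2) + e ^ 3 * Real.cos E) * hs
  rw [circleAvg_eq_of_hasDerivAt hd (by fun_prop)]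
  simp
  field_simp

end Kepler

/-! ### Differentiation of the averaged interaction with respect to the scaling factor -/

theorem continuous_circleAvg {f : ℝ → ℝ → ℝ} (hf : Continuous (Function.uncurry f)) :
    Continuous fun l => circleAvg (f l) :=
  (intervalIntegral.continuous_parametric_intervalIntegral_of_continuous' hf _ _).const_mul _

theorem abs_circleAvg_le {f : ℝ → ℝ} {B : ℝ} (h : ∀ l, |f l| ≤ B) : |circleAvg f| ≤ B := by
  have h2 := intervalIntegral.norm_integral_le_of_norm_le_const (a := 0) (b := 2 * Real.pi)
    (f := f) (C := B) (fun l _ => h l)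
  have hpi := Real.two_pi_pos
  rw [sub_zero, abs_of_pos hpi, Real.norm_eq_abs] at h2
  rw [circleAvg, abs_mul, abs_of_pos (inv_pos.2 hpi), inv_mul_le_iff₀ hpi]
  linarith

theorem hasDerivAt_circleAvg {f f' : ℝ → ℝ → ℝ} {s : Set ℝ} (hs : IsOpen s)
    (hf : ∀ ε ∈ s, Continuous (f ε)) (hf' : ∀ ε ∈ s, Continuous (f' ε)) {B : ℝ}
    (hB : ∀ ε ∈ s, ∀ l, |f' ε l| ≤ B)
    (hd : ∀ ε ∈ s, ∀ l, HasDerivAt (fun ε => f ε l) (f' ε l) ε) {ε : ℝ} (hε : ε ∈ s) :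
    HasDerivAt (fun ε => circleAvg (f ε)) (circleAvg (f' ε)) ε := by
  have hnhds := hs.mem_nhds hε
  refine ((intervalIntegral.hasDerivAt_integral_of_dominated_loc_of_deriv_le
    (bound := fun _ => B) hnhds ?_ ((hf ε hε).intervalIntegrable _ _)
    (hf' ε hε).aestronglyMeasurable ?_ intervalIntegrable_const ?_).2).const_mul _
  · filter_upwards [hnhds] with x hx using (hf x hx).aestronglyMeasurable
  · exact Filter.Eventually.of_forall fun l _ x hx => hB x hx l
  · exact Filter.Eventually.of_forall fun l _ x hx => hd x hx l

theorem hasDerivAt_circleAvg_circleAvg {f f' : ℝ → ℝ → ℝ → ℝ} {s : Set ℝ} (hs : IsOpen s)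
    (hf : ∀ ε ∈ s, Continuous (Function.uncurry (f ε)))
    (hf' : ∀ ε ∈ s, Continuous (Function.uncurry (f' ε))) {B : ℝ}
    (hB : ∀ ε ∈ s, ∀ l l', |f' ε l l'| ≤ B)
    (hd : ∀ ε ∈ s, ∀ l l', HasDerivAt (fun ε => f ε l l') (f' ε l l') ε) {ε : ℝ} (hε : ε ∈ s) :
    HasDerivAt (fun ε => circleAvg fun l => circleAvg (f ε l))
      (circleAvg fun l => circleAvg (f' ε l)) ε :=
  hasDerivAt_circleAvg hs (fun ε hε => continuous_circleAvg (hf ε hε))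
    (fun ε hε => continuous_circleAvg (hf' ε hε))
    (fun ε hε l => abs_circleAvg_le (hB ε hε l))
    (fun _ hε l => hasDerivAt_circleAvg hs
      (fun ε hε => (hf ε hε).comp (Continuous.prodMk_right l))
      (fun ε hε => (hf' ε hε).comp (Continuous.prodMk_right l))
      (fun ε hε l' => hB ε hε l l') (fun ε hε l' => hd ε hε l l') hε) hε

/-- The third derivative serves only to make the second one continuous. -/
theorem contDiffAt_two_of_hasDerivAt {G₀ G₁ G₂ G₃ : ℝ → ℝ} {s : Set ℝ} (hs : IsOpen s)
    (h₀ : ∀ ε ∈ s, HasDerivAt G₀ (G₁ ε) ε) (h₁ : ∀ ε ∈ s, HasDerivAt G₁ (G₂ ε) ε)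
    (h₂ : ∀ ε ∈ s, HasDerivAt G₂ (G₃ ε) ε) {ε : ℝ} (hε : ε ∈ s) :
    ContDiffAt ℝ 2 G₀ ε ∧ iteratedDeriv 2 G₀ ε = G₂ ε := by
  have e₀ : Set.EqOn (deriv G₀) G₁ s := fun x hx => (h₀ x hx).deriv
  have e₁ : Set.EqOn (deriv G₁) G₂ s := fun x hx => (h₁ x hx).deriv
  have c₁ : ContDiffOn ℝ 1 G₁ s := by
    rw [show (1 : WithTop ℕ∞) = 0 + 1 by norm_num, contDiffOn_succ_iff_deriv_of_isOpen hs]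
    refine ⟨fun x hx => (h₁ x hx).differentiableAt.differentiableWithinAt, by simp, ?_⟩
    refine ContDiffOn.congr ?_ e₁
    exact contDiffOn_zero.2 fun x hx => (h₂ x hx).continuousAt.continuousWithinAt
  have c₀ : ContDiffOn ℝ 2 G₀ s := by
    rw [show (2 : WithTop ℕ∞) = 1 + 1 by norm_num, contDiffOn_succ_iff_deriv_of_isOpen hs]
    exact ⟨fun x hx => (h₀ x hx).differentiableAt.differentiableWithinAt, by simp, c₁.congr e₀⟩
  refine ⟨c₀.contDiffAt (hs.mem_nhds hε), ?_⟩
  rw [iteratedDeriv_succ, iteratedDeriv_one,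
    (Filter.eventuallyEq_of_mem (hs.mem_nhds hε) e₀).deriv_eq, e₁ hε]

section Newton

variable {x y : E3}

theorem hasDerivAt_inv_norm_smul_sub {ε : ℝ} (h : ε • x - y ≠ 0) :
    HasDerivAt (fun ε : ℝ => ‖ε • x - y‖⁻¹)
      (inner ℝ x (y - ε • x) * ‖ε • x - y‖⁻¹ ^ 3) ε := by
  have hr := norm_pos_iff.2 h
  have h1 : HasDerivAt (fun ε : ℝ => ε • x - y) x ε := by
    simpa using ((hasDerivAt_id ε).smul_const x).sub_const y
  have h2 := (h1.norm_sq.sqrt (by positivity)).inv (by positivity)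
  simp only [Real.sqrt_sq (norm_nonneg _)] at h2
  refine h2.congr_deriv ?_
  rw [← neg_sub (ε • x) y, inner_neg_right, real_inner_comm]
  field_simp

theorem hasDerivAt_inner_sub_smul (x y : E3) (ε : ℝ) :
    HasDerivAt (fun ε : ℝ => inner ℝ x (y - ε • x)) (-‖x‖ ^ 2) ε := by
  simp only [inner_sub_right, inner_smul_right, real_inner_self_eq_norm_sq]
  simpa using ((hasDerivAt_id ε).mul_const (‖x‖ ^ 2)).const_sub (inner ℝ x y)

/-- The second derivative of `ε ↦ 1 / ‖ε x - y‖`. -/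
def newtonTwo (x y : E3) (ε : ℝ) : ℝ :=
  -‖x‖ ^ 2 * ‖ε • x - y‖⁻¹ ^ 3 + 3 * inner ℝ x (y - ε • x) ^ 2 * ‖ε • x - y‖⁻¹ ^ 5

/-- The third derivative of `ε ↦ 1 / ‖ε x - y‖`. -/
def newtonThree (x y : E3) (ε : ℝ) : ℝ :=
  -9 * ‖x‖ ^ 2 * inner ℝ x (y - ε • x) * ‖ε • x - y‖⁻¹ ^ 5 +
    15 * inner ℝ x (y - ε • x) ^ 3 * ‖ε • x - y‖⁻¹ ^ 7

theorem hasDerivAt_newtonOne {ε : ℝ} (h : ε • x - y ≠ 0) :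
    HasDerivAt (fun ε : ℝ => inner ℝ x (y - ε • x) * ‖ε • x - y‖⁻¹ ^ 3) (newtonTwo x y ε) ε := by
  refine ((hasDerivAt_inner_sub_smul x y ε).mul
    ((hasDerivAt_inv_norm_smul_sub h).pow 3)).congr_deriv ?_
  simp only [newtonTwo, Pi.pow_apply]; push_cast; ring

theorem hasDerivAt_newtonTwo {ε : ℝ} (h : ε • x - y ≠ 0) :
    HasDerivAt (newtonTwo x y) (newtonThree x y ε) ε := by
  have hu := hasDerivAt_inner_sub_smul x y ε
  have hs := hasDerivAt_inv_norm_smul_sub h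
  refine (((hs.pow 3).const_mul (-‖x‖ ^ 2)).add
    (((hu.pow 2).const_mul 3).mul (hs.pow 5))).congr_deriv ?_
  simp only [newtonThree, Pi.pow_apply]; push_cast; ring

theorem abs_inner_mul_inv_norm_le (x y : E3) (ε : ℝ) :
    |inner ℝ x (y - ε • x) * ‖ε • x - y‖⁻¹| ≤ ‖x‖ := by
  rw [norm_sub_rev, abs_mul, abs_of_nonneg (inv_nonneg.2 (norm_nonneg _)), ← div_eq_mul_inv]
  exact div_le_of_le_mul₀ (norm_nonneg _) (norm_nonneg _) (abs_real_inner_le_norm _ _)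

/-! The `k`-th derivative of `ε ↦ 1 / ‖ε x - y‖` is at most a constant times `X ^ k * R ^ (k + 1)`,
if `‖x‖ ≤ X` and `1 / ‖ε x - y‖ ≤ R`. -/

variable {X R : ℝ}

theorem abs_newtonOne_le (hx : ‖x‖ ≤ X) {ε : ℝ} (hR : ‖ε • x - y‖⁻¹ ≤ R) :
    |inner ℝ x (y - ε • x) * ‖ε • x - y‖⁻¹ ^ 3| ≤ X * R ^ 2 := by
  have h := abs_inner_mul_inv_norm_le x y ε
  have hs : 0 ≤ ‖ε • x - y‖⁻¹ := by positivity
  generalize inner ℝ x (y - ε • x) = u at *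
  generalize ‖ε • x - y‖⁻¹ = s at *
  have hX0 : 0 ≤ X := (norm_nonneg x).trans hx
  have h' := h.trans hx
  calc |u * s ^ 3| = |u * s| * s ^ 2 := by
        rw [show u * s ^ 3 = u * s * s ^ 2 by ring, abs_mul _ (s ^ 2), abs_of_nonneg (sq_nonneg s)]
    _ ≤ X * R ^ 2 := by gcongr

theorem abs_newtonTwo_le (hx : ‖x‖ ≤ X) {ε : ℝ} (hR : ‖ε • x - y‖⁻¹ ≤ R) :
    |newtonTwo x y ε| ≤ 4 * X ^ 2 * R ^ 3 := by
  have h := abs_inner_mul_inv_norm_le x y ε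
  have hs : 0 ≤ ‖ε • x - y‖⁻¹ := by positivity
  unfold newtonTwo
  generalize inner ℝ x (y - ε • x) = u at *
  generalize ‖ε • x - y‖⁻¹ = s at *
  have hX0 : 0 ≤ X := (norm_nonneg x).trans hx
  have h' := h.trans hx
  calc |-‖x‖ ^ 2 * s ^ 3 + 3 * u ^ 2 * s ^ 5|
      = |-‖x‖ ^ 2 * s ^ 3 + 3 * (u * s) ^ 2 * s ^ 3| := by congr 1; ring
    _ ≤ ‖x‖ ^ 2 * s ^ 3 + 3 * |u * s| ^ 2 * s ^ 3 := by
        refine (abs_add_le _ _).trans (le_of_eq ?_)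
        simp only [abs_mul, abs_neg, abs_pow, abs_norm, abs_of_nonneg hs]
        norm_num
    _ ≤ X ^ 2 * R ^ 3 + 3 * X ^ 2 * R ^ 3 := by gcongr
    _ = _ := by ring

theorem abs_newtonThree_le (hx : ‖x‖ ≤ X) {ε : ℝ} (hR : ‖ε • x - y‖⁻¹ ≤ R) :
    |newtonThree x y ε| ≤ 24 * X ^ 3 * R ^ 4 := by
  have h := abs_inner_mul_inv_norm_le x y ε
  have hs : 0 ≤ ‖ε • x - y‖⁻¹ := by positivity
  unfold newtonThree
  generalize inner ℝ x (y - ε • x) = u at *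
  generalize ‖ε • x - y‖⁻¹ = s at *
  have hX0 : 0 ≤ X := (norm_nonneg x).trans hx
  have h' := h.trans hx
  calc |-9 * ‖x‖ ^ 2 * u * s ^ 5 + 15 * u ^ 3 * s ^ 7|
      = |-9 * ‖x‖ ^ 2 * (u * s) * s ^ 4 + 15 * (u * s) ^ 3 * s ^ 4| := by congr 1; ring
    _ ≤ 9 * ‖x‖ ^ 2 * |u * s| * s ^ 4 + 15 * |u * s| ^ 3 * s ^ 4 := by
        refine (abs_add_le _ _).trans (le_of_eq ?_)
        simp only [abs_mul, abs_neg, abs_pow, abs_norm, abs_of_nonneg hs]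
        norm_num
    _ ≤ 9 * X ^ 2 * X * R ^ 4 + 15 * X ^ 3 * R ^ 4 := by gcongr
    _ = _ := by ring

end Newton

/-- The averaged Newtonian interaction of two curves, the first of which is scaled by a
factor `ε`, is twice continuously differentiable at `ε = 0`, with the second derivative obtained
under the integral sign. -/
theorem contDiffAt_averaged_newton {x y : ℝ → E3} (hx : Continuous x) (hy : Continuous y)
    {X m : ℝ} (hX : ∀ l, ‖x l‖ ≤ X) (hm : 0 < m) (hY : ∀ l, m ≤ ‖y l‖) :
    let G : ℝ → ℝ := fun ε => circleAvg fun l => circleAvg fun l' => 1 / ‖ε • x l - y l'‖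
    ContDiffAt ℝ 2 G 0 ∧ iteratedDeriv 2 G 0 = circleAvg fun l => circleAvg fun l' =>
      (3 * inner ℝ (x l) (y l') ^ 2 - ‖x l‖ ^ 2 * ‖y l'‖ ^ 2) / ‖y l'‖ ^ 5 := by
  intro G
  have hX0 : 0 ≤ X := (norm_nonneg _).trans (hX 0)
  set s := Metric.ball (0 : ℝ) (m / (2 * (X + 1))) with hs
  -- on this ball `‖ε x‖ ≤ m / 2`, hence `‖ε x - y‖ ≥ m / 2`
  have hr : ∀ ε ∈ s, ∀ l l', m / 2 ≤ ‖ε • x l - y l'‖ := by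
    intro ε hε l l'
    rw [hs, mem_ball_zero_iff, lt_div_iff₀ (by positivity), Real.norm_eq_abs] at hε
    have h1 : ‖ε • x l‖ ≤ m / 2 := by
      rw [norm_smul, Real.norm_eq_abs]
      nlinarith [hX l, abs_nonneg ε, mul_le_mul_of_nonneg_left (hX l) (abs_nonneg ε)]
    have h2 := norm_sub_norm_le (y l') (ε • x l)
    rw [norm_sub_rev] at h2
    linarith [hY l']
  have hne : ∀ ε ∈ s, ∀ l l', ε • x l - y l' ≠ 0 := fun ε hε l l' =>
    norm_pos_iff.1 ((half_pos hm).trans_le (hr ε hε l l'))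
  have hR : ∀ ε ∈ s, ∀ l l', ‖ε • x l - y l'‖⁻¹ ≤ (m / 2)⁻¹ := fun ε hε l l' =>
    inv_anti₀ (half_pos hm) (hr ε hε l l')
  have hc : ∀ ε ∈ s, Continuous fun p : ℝ × ℝ => ‖ε • x p.1 - y p.2‖⁻¹ := fun ε hε =>
    Continuous.inv₀ (by fun_prop) fun p => norm_ne_zero_iff.2 (hne ε hε p.1 p.2)
  have hx₁ : Continuous fun p : ℝ × ℝ => x p.1 := hx.comp continuous_fst
  have hu : ∀ ε : ℝ, Continuous fun p : ℝ × ℝ => inner ℝ (x p.1) (y p.2 - ε • x p.1) := fun ε =>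
    hx₁.inner ((hy.comp continuous_snd).sub (hx₁.fun_const_smul ε))
  have hx' : Continuous fun p : ℝ × ℝ => ‖x p.1‖ := hx₁.norm
  have hopen : IsOpen s := Metric.isOpen_ball
  have c₁ : ∀ ε ∈ s, Continuous (Function.uncurry fun l l' =>
      inner ℝ (x l) (y l' - ε • x l) * ‖ε • x l - y l'‖⁻¹ ^ 3) := fun ε hε =>
    (hu ε).mul ((hc ε hε).pow 3)
  have c₂ : ∀ ε ∈ s, Continuous (Function.uncurry fun l l' => newtonTwo (x l) (y l') ε) :=
    fun ε hε => ((hx'.pow 2).neg.mul ((hc ε hε).pow 3)).add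
      ((continuous_const.mul ((hu ε).pow 2)).mul ((hc ε hε).pow 5))
  have c₃ : ∀ ε ∈ s, Continuous (Function.uncurry fun l l' => newtonThree (x l) (y l') ε) :=
    fun ε hε => (((continuous_const.mul (hx'.pow 2)).mul (hu ε)).mul ((hc ε hε).pow 5)).add
      ((continuous_const.mul ((hu ε).pow 3)).mul ((hc ε hε).pow 7))
  have h0 : (0 : ℝ) ∈ s := Metric.mem_ball_self (by positivity)
  have key := contDiffAt_two_of_hasDerivAt hopen
    (fun _ hε => hasDerivAt_circleAvg_circleAvg
      (f := fun ε l l' => ‖ε • x l - y l'‖⁻¹) hopen hc c₁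
      (fun ε hε l l' => abs_newtonOne_le (hX l) (hR ε hε l l'))
      (fun ε hε l l' => hasDerivAt_inv_norm_smul_sub (hne ε hε l l')) hε)
    (fun _ hε => hasDerivAt_circleAvg_circleAvg hopen c₁ c₂
      (fun ε hε l l' => abs_newtonTwo_le (hX l) (hR ε hε l l'))
      (fun ε hε l l' => hasDerivAt_newtonOne (hne ε hε l l')) hε)
    (fun _ hε => hasDerivAt_circleAvg_circleAvg hopen c₂ c₃
      (fun ε hε l l' => abs_newtonThree_le (hX l) (hR ε hε l l'))
      (fun ε hε l l' => hasDerivAt_newtonTwo (hne ε hε l l')) hε) h0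
  simp only [G, one_div]
  refine ⟨key.1, key.2.trans ?_⟩
  congr 1; ext l; congr 1; ext l'
  have hy0 : 0 < ‖y l'‖ := hm.trans_le (hY l')
  simp only [newtonTwo, zero_smul, zero_sub, sub_zero, norm_neg]
  field_simp
  ring


/-! ### The Keplerian ellipses -/

section Ellipse

variable {n : ℕ} {S : System n} {z : Point n}

theorem System.M_pos (S : System n) (i : Fin n) : 0 < S.M i := by
  have := S.mbar0_pos; have := S.mbar_pos i; have := S.μ_pos
  unfold System.M; positivity

theorem System.m_pos (S : System n) (i : Fin n) : 0 < S.m i := by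
  have := S.mbar0_pos; have := S.mbar_pos i; have := S.μ_pos
  unfold System.m; positivity

theorem ecc_nonneg (z : Point n) (i : Fin n) : 0 ≤ z.ecc i := Real.sqrt_nonneg _

theorem one_sub_ratio_pos (hz : z ∈ rpsDomain n) (i : Fin n) :
    0 < 1 - ((z.η i) ^ 2 + (z.ξ i) ^ 2) / (2 * z.Λ i) := by
  have h1 := hz.1 i
  have h2 := hz.2.1 i
  rw [sub_pos, div_lt_one (by positivity)]
  linarith

theorem ecc_sq (hz : z ∈ rpsDomain n) (i : Fin n) :
    z.ecc i ^ 2 = 1 - (1 - ((z.η i) ^ 2 + (z.ξ i) ^ 2) / (2 * z.Λ i)) ^ 2 := by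
  have h1 := hz.1 i
  have h2 := one_sub_ratio_pos hz i
  have h3 : 0 ≤ ((z.η i) ^ 2 + (z.ξ i) ^ 2) / (2 * z.Λ i) := by positivity
  have h4 : ((z.η i) ^ 2 + (z.ξ i) ^ 2) / z.Λ i =
      2 * (((z.η i) ^ 2 + (z.ξ i) ^ 2) / (2 * z.Λ i)) := by field_simp
  rw [Point.ecc, h4, Real.sq_sqrt]
  · ring
  · nlinarith

theorem ecc_lt_one (hz : z ∈ rpsDomain n) (i : Fin n) : z.ecc i < 1 := by
  have h := ecc_sq hz i
  have h2 := pow_pos (one_sub_ratio_pos hz i) 2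
  nlinarith [ecc_nonneg z i]

theorem sqrt_one_sub_ecc_sq (hz : z ∈ rpsDomain n) (i : Fin n) :
    √(1 - z.ecc i ^ 2) = 1 - ((z.η i) ^ 2 + (z.ξ i) ^ 2) / (2 * z.Λ i) := by
  rw [ecc_sq hz, sub_sub_cancel, Real.sqrt_sq (one_sub_ratio_pos hz i).le]

theorem sqrt_one_sub_ecc_sq_pos (hz : z ∈ rpsDomain n) (i : Fin n) : 0 < √(1 - z.ecc i ^ 2) :=
  Real.sqrt_pos.2 (one_sub_sq_pos (ecc_nonneg z i) (ecc_lt_one hz i))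

theorem Gam_eq (hz : z ∈ rpsDomain n) (i : Fin n) :
    z.Gam i = z.Λ i * √(1 - z.ecc i ^ 2) := by
  have h1 := hz.1 i
  rw [sqrt_one_sub_ecc_sq hz, Point.Gam]
  field_simp

theorem semiAxis_pos (S : System n) (hz : z ∈ rpsDomain n) (i : Fin n) : 0 < semiAxis S z i := by
  have := S.M_pos i; have := S.m_pos i; have := hz.1 i
  unfold semiAxis; positivity

theorem Λ_sq (S : System n) (z : Point n) (i : Fin n) :
    z.Λ i ^ 2 = S.M i * S.m i ^ 2 * semiAxis S z i := by
  have := S.M_pos i; have := S.m_pos i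
  unfold semiAxis; field_simp

theorem m_mul_meanMotion (S : System n) (hz : z ∈ rpsDomain n) (i : Fin n) :
    S.m i * meanMotion S z i * semiAxis S z i ^ 2 = z.Λ i := by
  have := S.M_pos i; have := S.m_pos i; have := hz.1 i
  unfold semiAxis meanMotion; field_simp

/-- The orbital frame of planet `i` whose first axis points to the perihelion. -/
def perihelionFrame (z : Point n) (i : Fin n) : Matrix (Fin 3) (Fin 3) ℝ :=
  z.frame i * rotZ (-argEcc z i)

theorem perihelionFrame_mem (hz : z ∈ rpsDomain n) (i : Fin n) :
    perihelionFrame z i ∈ Matrix.specialOrthogonalGroup (Fin 3) ℝ :=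
  mul_mem (Point.frame_mem hz i) (rotZ_mem_specialOrthogonalGroup _)

theorem cross_position_momentum (S : System n) (hz : z ∈ rpsDomain n) (i : Fin n) (l : ℝ) :
    cross (position S z i l) (momentum S z i l) =
      WithLp.toLp 2 (perihelionFrame z i *ᵥ ![0, 0, z.Gam i]) := by
  unfold position momentum
  rw [← perihelionFrame, cross_toLp_mulVec (perihelionFrame_mem hz i)]
  congr 2
  have hD := one_sub_mul_cos_pos (ecc_nonneg z i) (ecc_lt_one hz i) (anomaly z i l)
  have hm := m_mul_meanMotion S hz i
  have hsc := Real.sin_sq_add_cos_sq (anomaly z i l)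
  rw [Gam_eq hz, ← hm]
  rw [mul_comm (z.ecc i)] at hD
  ext k
  fin_cases k
  · simp [cross_apply]
  · simp [cross_apply]
  · simp [cross_apply]
    field_simp
    linear_combination S.m i * meanMotion S z i * semiAxis S z i ^ 2 *
      √(1 - z.ecc i ^ 2) * hsc

theorem angMom_eq (S : System n) (hz : z ∈ rpsDomain n) (i : Fin n) :
    angMom S z i = WithLp.toLp 2 (perihelionFrame z i *ᵥ ![0, 0, z.Gam i]) :=
  cross_position_momentum S hz i 0

theorem norm_angMom (S : System n) (hz : z ∈ rpsDomain n) (i : Fin n) :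
    ‖angMom S z i‖ = z.Gam i := by
  rw [← sq_eq_sq₀ (norm_nonneg _) (Point.Gam_pos hz i).le, angMom_eq S hz,
    norm_sq_toLp_mulVec (perihelionFrame_mem hz i)]
  simp [dotProduct, Fin.sum_univ_three, sq]

theorem norm_position (S : System n) (hz : z ∈ rpsDomain n) (i : Fin n) (l : ℝ) :
    ‖position S z i l‖ = semiAxis S z i * (1 - z.ecc i * Real.cos (anomaly z i l)) := by
  have hD := one_sub_mul_cos_pos (ecc_nonneg z i) (ecc_lt_one hz i) (anomaly z i l)
  have ha := semiAxis_pos S hz i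
  have hb := Real.sq_sqrt (one_sub_sq_pos (ecc_nonneg z i) (ecc_lt_one hz i)).le
  have hsc := Real.sin_sq_add_cos_sq (anomaly z i l)
  rw [← sq_eq_sq₀ (norm_nonneg _) (by positivity), position, ← perihelionFrame,
    norm_sq_toLp_mulVec (perihelionFrame_mem hz i)]
  simp [dotProduct, Fin.sum_univ_three]
  linear_combination (semiAxis S z i ^ 2 * Real.sin (anomaly z i l) ^ 2) * hb +
    semiAxis S z i ^ 2 * (1 - z.ecc i ^ 2) * hsc

theorem continuous_anomaly (hz : z ∈ rpsDomain n) (i : Fin n) : Continuous (anomaly z i) :=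
  (continuous_eccAnomaly (ecc_nonneg z i) (ecc_lt_one hz i)).comp (continuous_add_const _)

theorem continuous_position (S : System n) (hz : z ∈ rpsDomain n) (i : Fin n) :
    Continuous (position S z i) := by
  have h := continuous_anomaly hz i
  refine (PiLp.continuous_toLp 2 _).comp (Continuous.matrix_mulVec continuous_const ?_)
  refine continuous_pi fun k => ?_
  fin_cases k <;> simp <;> fun_prop

theorem position_ne_zero (S : System n) (hz : z ∈ rpsDomain n) (i : Fin n) (l : ℝ) :
    position S z i l ≠ 0 := by
  rw [← norm_pos_iff, norm_position S hz]
  exact mul_pos (semiAxis_pos S hz i) (one_sub_mul_cos_pos (ecc_nonneg z i) (ecc_lt_one hz i) _)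

theorem norm_position_le (S : System n) (hz : z ∈ rpsDomain n) (i : Fin n) (l : ℝ) :
    ‖position S z i l‖ ≤ semiAxis S z i * (1 + z.ecc i) := by
  rw [norm_position S hz]
  refine mul_le_mul_of_nonneg_left ?_ (semiAxis_pos S hz i).le
  nlinarith [ecc_nonneg z i, Real.neg_one_le_cos (anomaly z i l)]

theorem le_norm_position (S : System n) (hz : z ∈ rpsDomain n) (i : Fin n) (l : ℝ) :
    semiAxis S z i * (1 - z.ecc i) ≤ ‖position S z i l‖ := by
  rw [norm_position S hz]
  refine mul_le_mul_of_nonneg_left ?_ (semiAxis_pos S hz i).le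
  nlinarith [ecc_nonneg z i, Real.cos_le_one (anomaly z i l)]

/-- Averages along the motion as averages over the eccentric anomaly. -/
theorem circleAvg_anomaly (hz : z ∈ rpsDomain n) (i : Fin n) {g : ℝ → ℝ} (hg : Continuous g)
    (hp : Function.Periodic g (2 * Real.pi)) :
    circleAvg (fun l => g (anomaly z i l)) =
      circleAvg (fun E => g E * (1 - z.ecc i * Real.cos E)) :=
  circleAvg_eccAnomaly (ecc_nonneg z i) (ecc_lt_one hz i) (argEcc z i) hg hp

theorem circleAvg_norm_position_sq (S : System n) (hz : z ∈ rpsDomain n) (i : Fin n) :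
    circleAvg (fun l => ‖position S z i l‖ ^ 2) =
      semiAxis S z i ^ 2 * (1 + 3 / 2 * z.ecc i ^ 2) := by
  simp only [norm_position S hz, mul_pow]
  rw [circleAvg_const_mul, circleAvg_anomaly hz i
    (g := fun E => (1 - z.ecc i * Real.cos E) ^ 2) (by fun_prop)
    (fun E => by simp only [Real.cos_add_two_pi]), ← circleAvg_one_sub_mul_cos_pow_three]
  congr 2

theorem circleAvg_inv_norm_position_sq (S : System n) (hz : z ∈ rpsDomain n) (i : Fin n) :
    circleAvg (fun l => 1 / ‖position S z i l‖ ^ 2) =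
      1 / (semiAxis S z i ^ 2 * √(1 - z.ecc i ^ 2)) := by
  have hD := one_sub_mul_cos_pos (ecc_nonneg z i) (ecc_lt_one hz i)
  have hne : ∀ E, (1 - z.ecc i * Real.cos E) ^ 2 ≠ 0 := fun E => pow_ne_zero 2 (hD E).ne'
  simp only [norm_position S hz, mul_pow]
  simp only [← one_div_mul_one_div]
  rw [circleAvg_const_mul, circleAvg_anomaly hz i
    (g := fun E => 1 / (1 - z.ecc i * Real.cos E) ^ 2) (by fun_prop (disch := exact hne))
    (fun E => by simp only [Real.cos_add_two_pi]),
    ← circleAvg_inv_one_sub_mul_cos (ecc_nonneg z i) (ecc_lt_one hz i)]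
  congr 2
  ext E
  have := (hD E).ne'
  field_simp

/-- The average along the motion of the quadrupole of a fixed vector. -/
theorem circleAvg_quadrupole_position (S : System n) (hz : z ∈ rpsDomain n) (j : Fin n) (x : E3) :
    circleAvg (fun l => (3 * inner ℝ x (position S z j l) ^ 2 - ‖x‖ ^ 2 *
      ‖position S z j l‖ ^ 2) / ‖position S z j l‖ ^ 5) =
    -1 / (2 * semiAxis S z j ^ 3 * √(1 - z.ecc j ^ 2) ^ 3 * ‖angMom S z j‖ ^ 2) *
      (3 * inner ℝ (angMom S z j) x ^ 2 - ‖x‖ ^ 2 * ‖angMom S z j‖ ^ 2) := by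
  have hA := perihelionFrame_mem hz j
  have ha := semiAxis_pos S hz j
  have hb := sqrt_one_sub_ecc_sq_pos hz j
  have hG := Point.Gam_pos hz j
  have hD := one_sub_mul_cos_pos (ecc_nonneg z j) (ecc_lt_one hz j)
  have hne : ∀ E, (1 - z.ecc j * Real.cos E) ≠ 0 := fun E => (hD E).ne'
  -- the components of `x` in the frame of the ellipse
  obtain ⟨w, rfl⟩ : ∃ w, x = WithLp.toLp 2 (perihelionFrame z j *ᵥ w) := by
    refine ⟨(perihelionFrame z j)ᵀ *ᵥ WithLp.ofLp x, ?_⟩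
    have h : perihelionFrame z j * (perihelionFrame z j)ᵀ = 1 :=
      (Matrix.mem_orthogonalGroup_iff ..).1 ((Matrix.mem_specialOrthogonalGroup_iff ..).1 hA).1
    rw [Matrix.mulVec_mulVec, h, Matrix.one_mulVec, WithLp.toLp_ofLp]
  simp only [norm_angMom S hz]
  rw [angMom_eq S hz, inner_toLp_mulVec hA, norm_sq_toLp_mulVec hA]
  have h1 : ∀ l, inner ℝ (WithLp.toLp 2 (perihelionFrame z j *ᵥ w)) (position S z j l) =
      semiAxis S z j * (w 0 * (Real.cos (anomaly z j l) - z.ecc j) +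
        w 1 * (√(1 - z.ecc j ^ 2) * Real.sin (anomaly z j l))) := by
    intro l
    rw [position, ← perihelionFrame, inner_toLp_mulVec hA]
    simp [dotProduct, Fin.sum_univ_three]
    ring
  simp only [h1, norm_position S hz]
  set a := semiAxis S z j
  set b := √(1 - z.ecc j ^ 2) with hbdef
  have h2 := circleAvg_anomaly hz j (g := fun E => 1 / a ^ 3 *
    ((3 * (w 0 * (Real.cos E - z.ecc j) + w 1 * (b * Real.sin E)) ^ 2 /
      (1 - z.ecc j * Real.cos E) ^ 2 - w ⬝ᵥ w) / (1 - z.ecc j * Real.cos E) ^ 3))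
    (by fun_prop (disch := exact fun E => pow_ne_zero _ (hne E)))
    (fun E => by simp only [Real.cos_add_two_pi, Real.sin_add_two_pi])
  have h3 := circleAvg_quadrupole (ecc_nonneg z j) (ecc_lt_one hz j) (w 0) (w 1) (w ⬝ᵥ w)
  rw [← hbdef] at h3
  calc _ = _ := by
        congr 1; ext l
        have := hne (anomaly z j l)
        rw [mul_comm (z.ecc j)] at this
        field_simp
    _ = _ := h2
    _ = circleAvg (fun E => 1 / a ^ 3 *
          ((3 * (w 0 * (Real.cos E - z.ecc j) + w 1 * (b * Real.sin E)) ^ 2 /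
            (1 - z.ecc j * Real.cos E) ^ 2 - w ⬝ᵥ w) / (1 - z.ecc j * Real.cos E) ^ 2)) := by
        congr 1; ext E
        have := hne E
        field_simp
    _ = _ := by
        rw [circleAvg_const_mul, h3]
        simp only [dotProduct, Fin.sum_univ_three]
        simp
        field_simp
        ring

end Ellipse

/-! ### The second-order term -/

section SecondOrder

variable {n : ℕ} {z : Point n}

theorem contDiffAt_scaledAverage (S : System n) (hz : z ∈ rpsDomain n) (i j : Fin n) :
    ContDiffAt ℝ 2 (scaledAverage S z i j) 0 :=
  (contDiffAt_averaged_newton (continuous_position S hz i) (continuous_position S hz j)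
    (norm_position_le S hz i) (mul_pos (semiAxis_pos S hz j) (sub_pos.2 (ecc_lt_one hz j)))
    (le_norm_position S hz j)).1

theorem fTerm_two (S : System n) (hz : z ∈ rpsDomain n) (i j : Fin n) :
    fTerm S z 2 i j =
      -1 / (4 * semiAxis S z j ^ 3 * √(1 - z.ecc j ^ 2) ^ 3 * ‖angMom S z j‖ ^ 2) *
        circleAvg (fun l => 3 * (inner ℝ (angMom S z j) (position S z i l)) ^ 2 -
          ‖position S z i l‖ ^ 2 * ‖angMom S z j‖ ^ 2) := by
  have h : iteratedDeriv 2 (scaledAverage S z i j) 0 = _ :=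
    (contDiffAt_averaged_newton (continuous_position S hz i) (continuous_position S hz j)
    (norm_position_le S hz i) (mul_pos (semiAxis_pos S hz j) (sub_pos.2 (ecc_lt_one hz j)))
    (le_norm_position S hz j)).2
  simp only [circleAvg_quadrupole_position S hz j] at h
  rw [circleAvg_const_mul] at h
  rw [fTerm, h, ← mul_assoc]
  congr 1
  norm_num [Nat.factorial]
  field_simp
  norm_num

theorem fTerm_two_eq_angMom (S : System n) (hz : z ∈ rpsDomain n) (i j : Fin n) :
    fTerm S z 2 i j =
      -(S.M j * (S.m j) ^ 2 / 4) *
        (circleAvg (fun l => 3 * (inner ℝ (angMom S z j) (position S z i l)) ^ 2 -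
          ‖position S z i l‖ ^ 2 * ‖angMom S z j‖ ^ 2) / ‖angMom S z j‖ ^ 4) *
        circleAvg (fun l => 1 / ‖position S z j l‖ ^ 2) := by
  have ha := semiAxis_pos S hz j
  have hb := sqrt_one_sub_ecc_sq_pos hz j
  have hG := Point.Gam_pos hz j
  have hΛ := Λ_sq S z j
  rw [fTerm_two S hz, circleAvg_inv_norm_position_sq S hz]
  generalize circleAvg _ = Q
  have hG2 : ‖angMom S z j‖ ^ 2 =
      S.M j * S.m j ^ 2 * semiAxis S z j * √(1 - z.ecc j ^ 2) ^ 2 := by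
    rw [norm_angMom S hz, Gam_eq hz, mul_pow, hΛ]
  have hG4 : ‖angMom S z j‖ ^ 4 = (S.M j * S.m j ^ 2 * semiAxis S z j *
      √(1 - z.ecc j ^ 2) ^ 2) ^ 2 := by rw [← hG2]; ring
  have := S.M_pos j; have := S.m_pos j
  rw [hG4, hG2]
  field_simp

theorem coupling_eq (S : System n) (hz : z ∈ rpsDomain n) (i j : Fin n) :
    coupling S z i j = semiAxis S z i ^ 2 / semiAxis S z j ^ 3 *
      (1 / √(1 - z.ecc j ^ 2) / √(1 - z.ecc j ^ 2) ^ 2) := by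
  rw [coupling, circleAvg_inv_one_sub_mul_cos (ecc_nonneg z j) (ecc_lt_one hz j),
    ← sqrt_one_sub_ecc_sq hz j]

theorem fTerm_two_eq_coupling (S : System n) (hz : z ∈ rpsDomain n) (i j : Fin n) :
    fTerm S z 2 i j = 1 / 4 * (coupling S z i j * (1 + 3 / 2 * (z.ecc i) ^ 2)) -
      3 / 4 * (coupling S z i j * circleAvg fun l => (inner ℝ ((semiAxis S z i)⁻¹ •
        position S z i l) (‖angMom S z j‖⁻¹ • angMom S z j)) ^ 2) := by
  have ha := semiAxis_pos S hz j
  have ha' := semiAxis_pos S hz i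
  have hb := sqrt_one_sub_ecc_sq_pos hz j
  have hG : 0 < ‖angMom S z j‖ := by rw [norm_angMom S hz]; exact Point.Gam_pos hz j
  have hc := continuous_position S hz i
  have h1 : (fun l => (inner ℝ ((semiAxis S z i)⁻¹ • position S z i l)
      (‖angMom S z j‖⁻¹ • angMom S z j)) ^ 2) = fun l =>
      (1 / (semiAxis S z i ^ 2 * ‖angMom S z j‖ ^ 2)) *
        inner ℝ (angMom S z j) (position S z i l) ^ 2 := by
    ext l
    rw [real_inner_smul_left, real_inner_smul_right, real_inner_comm]
    field_simp
  have h2 : (fun l => ‖position S z i l‖ ^ 2 * ‖angMom S z j‖ ^ 2) =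
      fun l => ‖angMom S z j‖ ^ 2 * ‖position S z i l‖ ^ 2 := by ext l; ring
  rw [fTerm_two S hz, coupling_eq S hz, h1, circleAvg_const_mul,
    circleAvg_sub (by fun_prop) (by fun_prop), circleAvg_const_mul, h2, circleAvg_const_mul,
    circleAvg_norm_position_sq S hz]
  field_simp
  ring

theorem secularTwo_eq (S : System n) (hz : z ∈ rpsDomain n) :
    secularTwo S z = planarFormula S z + verticalFormula S z := by
  simp only [secularTwo, planarFormula, verticalFormula, fTerm_two_eq_coupling S hz,
    Finset.mul_sum, ← Finset.sum_neg_distrib, ← Finset.sum_add_distrib]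
  refine Finset.sum_congr rfl fun i _ => Finset.sum_congr rfl fun j _ => ?_
  ring

theorem verticalFormula_planarPoint (S : System n) {Λ : Fin n → ℝ} (hΛ : ∀ i, 0 < Λ i)
    {w : PlanarSpace n} (hw : w ∈ planarDomain Λ) : verticalFormula S (planarPoint Λ w) = 0 := by
  have hz := planarPoint_mem_rpsDomain hΛ hw
  have h : ∀ i j l, inner ℝ (position S (planarPoint Λ w) i l) (angMom S (planarPoint Λ w) j) =
      0 := by
    intro i j l
    rw [angMom_eq S hz, position, perihelionFrame, frame_planarPoint, frame_planarPoint]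
    rw [one_mul, one_mul, EuclideanSpace.inner_toLp_toLp]
    simp [rotZ, dotProduct, Fin.sum_univ_three, Matrix.mulVec, -Matrix.mulVec_cons]
  simp only [verticalFormula, real_inner_smul_left, real_inner_smul_right, h, mul_zero,
    ne_eq, OfNat.ofNat_ne_zero, not_false_eq_true, zero_pow, circleAvg_const,
    Finset.sum_const_zero]

theorem planarPart_eq (S : System n) {Λ : Fin n → ℝ} (hΛ : ∀ i, 0 < Λ i)
    {w : PlanarSpace n} (hw : w ∈ planarDomain Λ) :
    planarPart S Λ w = planarFormula S (planarPoint Λ w) := by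
  rw [planarPart, secularTwo_eq S (planarPoint_mem_rpsDomain hΛ hw),
    verticalFormula_planarPoint S hΛ hw, add_zero]

end SecondOrder

/-! ### Functions of the actions -/

section Actions

variable {n : ℕ}

/-- The differential of the actions. -/
def actionsDeriv (w : PlanarSpace n) : PlanarSpace n →L[ℝ] (Fin n → ℝ) :=
  ContinuousLinearMap.pi fun i =>
    w.1 i • (ContinuousLinearMap.proj i).comp (ContinuousLinearMap.fst ℝ _ _) +
      w.2 i • (ContinuousLinearMap.proj i).comp (ContinuousLinearMap.snd ℝ _ _)

theorem hasFDerivAt_actions (w : PlanarSpace n) : HasFDerivAt actions (actionsDeriv w) w := by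
  refine hasFDerivAt_pi.2 fun i => ?_
  have h1 : HasFDerivAt (fun w : PlanarSpace n => w.1 i)
      ((ContinuousLinearMap.proj i).comp (ContinuousLinearMap.fst ℝ _ _)) w :=
    ((ContinuousLinearMap.proj (R := ℝ) (φ := fun _ : Fin n => ℝ) i).comp
      (ContinuousLinearMap.fst ℝ (Fin n → ℝ) (Fin n → ℝ))).hasFDerivAt
  have h2 : HasFDerivAt (fun w : PlanarSpace n => w.2 i)
      ((ContinuousLinearMap.proj i).comp (ContinuousLinearMap.snd ℝ _ _)) w :=
    ((ContinuousLinearMap.proj (R := ℝ) (φ := fun _ : Fin n => ℝ) i).comp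
      (ContinuousLinearMap.snd ℝ (Fin n → ℝ) (Fin n → ℝ))).hasFDerivAt
  refine (((h1.pow 2).add (h2.pow 2)).mul_const (2⁻¹ : ℝ)).congr_fderiv ?_
  ext v <;> simp <;> ring

theorem actionsDeriv_fst (w : PlanarSpace n) (k : Fin n) :
    actionsDeriv w (Pi.single k 1, 0) = w.1 k • Pi.single k 1 := by
  ext i
  by_cases h : i = k
  · subst h; simp [actionsDeriv]
  · simp [actionsDeriv, h]

theorem actionsDeriv_snd (w : PlanarSpace n) (k : Fin n) :
    actionsDeriv w (0, Pi.single k 1) = w.2 k • Pi.single k 1 := by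
  ext i
  by_cases h : i = k
  · subst h; simp [actionsDeriv]
  · simp [actionsDeriv, h]

theorem contDiff_actions : ContDiff ℝ ∞ (actions (n := n)) := by
  unfold actions
  fun_prop

/-- Two functions of the actions are in involution. -/
theorem poisson_eq_zero_of_actions {F G : PlanarSpace n → ℝ} {f g : (Fin n → ℝ) → ℝ}
    {w : PlanarSpace n} (hF : F =ᶠ[nhds w] f ∘ actions) (hG : G =ᶠ[nhds w] g ∘ actions)
    (hf : DifferentiableAt ℝ f (actions w)) (hg : DifferentiableAt ℝ g (actions w)) :
    poisson F G w = 0 := by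
  have e1 := (hf.hasFDerivAt.comp w (hasFDerivAt_actions w)).congr_of_eventuallyEq hF
  have e2 := (hg.hasFDerivAt.comp w (hasFDerivAt_actions w)).congr_of_eventuallyEq hG
  refine Finset.sum_eq_zero fun k _ => ?_
  rw [e1.fderiv, e2.fderiv]
  simp only [ContinuousLinearMap.comp_apply, actionsDeriv_fst, actionsDeriv_snd, map_smul,
    smul_eq_mul]
  ring

theorem isOpen_planarDomain (Λ : Fin n → ℝ) : IsOpen (planarDomain Λ) := by
  simp only [planarDomain, Set.ofPred_forall]
  exact isOpen_iInter_of_finite fun i => isOpen_lt (by fun_prop) continuous_const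

/-- The actions are independent off the hyperplanes `η_i = 0`. -/
theorem linearIndependent_fderiv_actions {w : PlanarSpace n} (hw : ∀ i, w.1 i ≠ 0) :
    LinearIndependent ℝ fun i => fderiv ℝ (fun w : PlanarSpace n => actions w i) w := by
  rw [Fintype.linearIndependent_iff]
  intro c hc k
  have h : ∀ i, fderiv ℝ (fun w : PlanarSpace n => actions w i) w =
      (ContinuousLinearMap.proj i).comp (actionsDeriv w) := fun i =>
    ((ContinuousLinearMap.proj (R := ℝ) (φ := fun _ : Fin n => ℝ) i).hasFDerivAt.comp w
      (hasFDerivAt_actions w)).fderiv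
  have h2 := DFunLike.congr_fun hc (Pi.single k 1, 0)
  simp only [h, _root_.sum_apply, _root_.smul_apply,
    ContinuousLinearMap.comp_apply, actionsDeriv_fst, ContinuousLinearMap.proj_apply,
    Pi.smul_apply, smul_eq_mul, _root_.zero_apply, Pi.single_apply, mul_ite, mul_one,
    mul_zero, Finset.sum_ite_eq', Finset.mem_univ, if_true, mul_eq_zero] at h2
  exact h2.resolve_right (hw k)

theorem dense_fst_ne_zero : Dense {w : PlanarSpace n | ∀ i, w.1 i ≠ 0} := by
  have h : Dense (Set.univ.pi fun _ : Fin n => ({0}ᶜ : Set ℝ)) :=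
    dense_pi Set.univ fun _ _ => dense_compl_singleton 0
  have h2 : {w : PlanarSpace n | ∀ i, w.1 i ≠ 0} =
      (Set.univ.pi fun _ : Fin n => ({0}ᶜ : Set ℝ)) ×ˢ (Set.univ : Set (Fin n → ℝ)) := by
    ext w; simp
  rw [h2]
  exact h.prod dense_univ

/-- A real-analytic function of the actions is integrable, with the actions as first integrals. -/
theorem liouvilleIntegrable_of_actions {H : PlanarSpace n → ℝ} {Λ : Fin n → ℝ}
    {g : (Fin n → ℝ) → ℝ} (hg : AnalyticOnNhd ℝ g (actions '' planarDomain Λ))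
    (hH : ∀ w ∈ planarDomain Λ, H w = g (actions w)) :
    LiouvilleIntegrable H (planarDomain Λ) := by
  have hopen := isOpen_planarDomain Λ
  have hK : ∀ i, (fun w : PlanarSpace n => actions w i) =
      (fun I : Fin n → ℝ => I i) ∘ actions := fun i => rfl
  refine ⟨?_, fun i w => actions w i, fun i => ?_, fun i w hw => ?_, fun i j w _ => ?_,
    planarDomain Λ ∩ {w | ∀ i, w.1 i ≠ 0}, Set.inter_subset_left, ?_, ?_, fun w hw => ?_⟩
  · refine ContDiffOn.congr (f := g ∘ actions) (fun w hw => ?_) hH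
    exact ((hg _ ⟨w, hw, rfl⟩).contDiffAt.comp w contDiff_actions.contDiffAt).contDiffWithinAt
  · exact (contDiff_pi.1 contDiff_actions i).contDiffOn
  · exact poisson_eq_zero_of_actions
      (Filter.eventuallyEq_of_mem (hopen.mem_nhds hw) hH) (hK i).eventuallyEq
      (hg _ ⟨w, hw, rfl⟩).differentiableAt (by fun_prop)
  · exact poisson_eq_zero_of_actions (hK i).eventuallyEq (hK j).eventuallyEq (by fun_prop)
      (by fun_prop)
  · refine hopen.inter ?_
    simp only [Set.ofPred_forall]
    exact isOpen_iInter_of_finite fun i => isOpen_ne_fun (by fun_prop) continuous_const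
  · exact dense_fst_ne_zero.open_subset_closure_inter hopen
  · exact linearIndependent_fderiv_actions hw.2

end Actions

/-! ### The planar part -/

section Planar

variable {n : ℕ}

/-- The planar part as a function of the actions `I`. The point of the phase space at which the
semi-axes are evaluated does not matter, since they depend on `Λ` only. -/
def planarNormalForm (S : System n) (Λ I : Fin n → ℝ) : ℝ :=
  -(1 / 4) * ∑ i : Fin n, ∑ j ∈ Finset.Ioi i, S.mbar i * S.mbar j *
    (semiAxis S (planarPoint Λ 0) i ^ 2 / semiAxis S (planarPoint Λ 0) j ^ 3) *
      ((1 - I j / Λ j) ^ 3)⁻¹ * (1 + 3 / 2 * (1 - (1 - I i / Λ i) ^ 2))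

theorem planarFormula_planarPoint (S : System n) {Λ : Fin n → ℝ} (hΛ : ∀ i, 0 < Λ i)
    {w : PlanarSpace n} (hw : w ∈ planarDomain Λ) :
    planarFormula S (planarPoint Λ w) = planarNormalForm S Λ (actions w) := by
  have hz := planarPoint_mem_rpsDomain hΛ hw
  rw [planarFormula, planarNormalForm]
  congr 1
  refine Finset.sum_congr rfl fun i _ => Finset.sum_congr rfl fun j _ => ?_
  have hu : ∀ k, ((planarPoint Λ w).η k ^ 2 + (planarPoint Λ w).ξ k ^ 2) /
      (2 * (planarPoint Λ w).Λ k) = actions w k / Λ k := fun k => by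
    rw [actions, div_div]; rfl
  have ha : ∀ k, semiAxis S (planarPoint Λ w) k = semiAxis S (planarPoint Λ 0) k := fun k => rfl
  rw [coupling_eq S hz, sqrt_one_sub_ecc_sq hz, ecc_sq hz, hu, hu, ha, ha]
  rw [div_div, ← pow_succ', one_div]
  ring

theorem analyticOnNhd_planarNormalForm (S : System n) {Λ : Fin n → ℝ} (hΛ : ∀ i, 0 < Λ i) :
    AnalyticOnNhd ℝ (planarNormalForm S Λ) (actions '' planarDomain Λ) := by
  rintro _ ⟨w, hw, rfl⟩
  have hp : ∀ k, AnalyticAt ℝ (fun I : Fin n → ℝ => 1 - I k / Λ k) (actions w) := fun k =>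
    analyticAt_const.sub (((ContinuousLinearMap.proj (R := ℝ) (φ := fun _ : Fin n => ℝ)
      k).analyticAt _).div analyticAt_const (hΛ k).ne')
  unfold planarNormalForm
  refine analyticAt_const.mul (Finset.analyticAt_fun_sum _ fun i _ =>
    Finset.analyticAt_fun_sum _ fun j _ => ?_)
  have hj : (1 - actions w j / Λ j) ^ 3 ≠ 0 :=
    pow_ne_zero _ (sub_pos.2 ((div_lt_one (hΛ j)).2 (hw j))).ne'
  exact (analyticAt_const.mul (((hp j).pow 3).inv hj)).mul
    (analyticAt_const.add (analyticAt_const.mul (analyticAt_const.sub ((hp i).pow 2))))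

end Planar

end Planetary
end

open Planetary in
theorem mainTheorem4 (n : ℕ) (S : System n) :
    (∀ z ∈ rpsDomain n,
      -- the Cartesian map is regular, and the angular momenta do not depend on the angles
      (∀ i, Continuous (position S z i) ∧ (∀ l, position S z i l ≠ 0) ∧ angMom S z i ≠ 0 ∧
        ∀ l, cross (position S z i l) (momentum S z i l) = angMom S z i) ∧
      -- the closed form of the second-order terms
      (∀ i j : Fin n, i < j →
        ContDiffAt ℝ 2 (scaledAverage S z i j) 0 ∧
        fTerm S z 2 i j =
          -(S.M j * (S.m j) ^ 2 / 4) *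
            (circleAvg (fun l => 3 * (inner ℝ (angMom S z j) (position S z i l)) ^ 2 -
              ‖position S z i l‖ ^ 2 * ‖angMom S z j‖ ^ 2) / ‖angMom S z j‖ ^ 4) *
            circleAvg (fun l => 1 / ‖position S z j l‖ ^ 2)) ∧
      -- the splitting into a planar and a vertical part
      secularTwo S z = planarPart S z.Λ (z.η, z.ξ) + verticalFormula S z ∧
      planarPart S z.Λ (z.η, z.ξ) = planarFormula S z) ∧
    -- the planar part is integrable and in Birkhoff normal form
    (∀ Λ : Fin n → ℝ, (∀ i, 0 < Λ i) →
      LiouvilleIntegrable (planarPart S Λ) (planarDomain Λ) ∧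
      InBirkhoffNormalForm (planarPart S Λ) (planarDomain Λ)) := by
  refine ⟨fun z hz => ⟨fun i => ⟨continuous_position S hz i, position_ne_zero S hz i, ?_,
    fun l => ?_⟩, fun i j _ => ⟨contDiffAt_scaledAverage S hz i j,
    fTerm_two_eq_angMom S hz i j⟩, ?_⟩, fun Λ hΛ => ?_⟩
  · rw [← norm_pos_iff, norm_angMom S hz]
    exact Point.Gam_pos hz i
  · rw [cross_position_momentum S hz, angMom_eq S hz]
  · -- the planar formula involves only `Λ`, `η` and `ξ`
    have h : planarPart S z.Λ (z.η, z.ξ) = planarFormula S z := planarPart_eq S hz.1 hz.2.1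
    exact ⟨by rw [h, secularTwo_eq S hz], h⟩
  · have h : ∀ w ∈ planarDomain Λ, planarPart S Λ w = planarNormalForm S Λ (actions w) :=
      fun w hw => by rw [planarPart_eq S hΛ hw, planarFormula_planarPoint S hΛ hw]
    have hg := analyticOnNhd_planarNormalForm S hΛ
    exact ⟨liouvilleIntegrable_of_actions hg h, planarNormalForm S Λ, hg, h⟩
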